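/- **Lemma (Tightness of the set size).** For a nonempty $S\subseteq\{0,1\}^n$ let $|\phi_S\rangle=|S|^{-1/2}\sum_{x\in S}|x\rangle$ be its subset state, and let $\mu_n$ be the Haar measure on the unit vectors of $\mathbb{C}^{2^n}$ ($n$-qubit pure states). A polynomial-time quantum algorithm is a uniform family of quantum circuits (gates Hadamard, $T$, NOT, CNOT, Toffoli; ancillas $|0\rangle$; the measurement of one output wire decides acceptance) whose $n$-th circuit is written by one fixed classical program in time polynomial in $n$. Write $\Pr[A(|\psi\rangle^{\otimes k})=1]$ for its acceptance probability on $k$ copies of $|\psi\rangle$. 1. (Small sets.) For every polynomial $p$ with rational coefficients there is a polynomial-time quantum algorithm $A$ which, with $m(n)=\max(\lfloor p(n)\rfloor,0)+1$ copies (so $m(n)=p(n)+1$ whenever $p(n)$ is a nonnegative integer), performs the collision test: for every $n$-qubit pure state $|\psi\rangle$, $\Pr[A(|\psi\rangle^{\otimes m(n)})=1]$ is the probability that two of $m(n)$ independent computational-basis measurements of $|\psi\rangle$ have the same outcome. It satisfies - $\Pr[A(|\phi_S\rangle^{\otimes m(n)})=1]=1$ for all $n$ and all nonempty $S\subseteq\{0,1\}^n$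 of size $s=p(n)$; - $\mathbb{E}_{\psi\sim\mu_n}\Pr[A(|\psi\rangle^{\otimes m(n)})=1]\le e^{-cn}$ for all sufficiently large $n$, for some constant $c>0$. 2. (Large sets.) There is a constant $c>0$ such that for every polynomial $p$ with rational coefficients there are a polynomial-time quantum algorithm $A$, a polynomially bounded number of copies $k(n)$ and a threshold $t(n)$ such that $A$ performs the repeated swap test against the uniform superposition $|u\rangle=2^{-n/2}\sum_{x}|x\rangle$: for every $n$-qubit pure state $|\psi\rangle$, $\Pr[A(|\psi\rangle^{\otimes k(n)})=1]$ is the probability that at least $t(n)$ of $k(n)$ independent trials succeed, each with the probability $\tfrac12\left(1+|\langle u|\psi\rangle|^2\right)$ that the swap test of $|\psi\rangle$ and $|u\rangle$ outputs "equal". For all sufficiently large $n$ and all nonempty $S\subseteq\{0,1\}^n$ of size $s=2^n/p(n)$ rounded up or down to an integer (i.e. $|s-2^n/p(n)|<1$), $$\Pr[A(|\phi_S\rangle^{\otimes k(n)})=1]-\mathbb{E}_{\psi\sim\mu_n}\Pr[A(|\psi\rangle^{\otimes k(n)})=1]\ \ge\ c .$$ -/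

import Mathlib

open MeasureTheory Filter Polynomial

/-! ### States of `n` qubits -/

/-- The Hilbert space of `n` qubits; the computational basis is indexed by `{0,1}^n`. -/
abbrev Qubits (n : ℕ) : Type := EuclideanSpace ℂ (Fin n → Bool)

/-- Pure states of `n` qubits: the unit vectors. -/
abbrev PureState (n : ℕ) : Type := Metric.sphere (0 : Qubits n) 1

/-- The Haar measure on pure states: the normalized surface measure of the unit sphere of
`ℂ^(2^n)`, which is its unitarily invariant Borel probability measure. -/
noncomputable def haarState (n : ℕ) : Measure (PureState n) :=
  ((volume : Measure (Qubits n)).toSphere Set.univ)⁻¹ • (volume : Measure (Qubits n)).toSphere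

/-- The vector `|S|^(-1/2) ∑_{x ∈ S} |x⟩`; it is the subset state of `S` when `S` is nonempty. -/
noncomputable def subsetState {n : ℕ} (S : Finset (Fin n → Bool)) : Qubits n :=
  WithLp.toLp 2 fun x => if x ∈ S then ((1 / Real.sqrt S.card : ℝ) : ℂ) else 0

/-! ### Quantum circuits

Wires are numbered by `ℕ`. A computational-basis state of all the wires, finitely many of which
carry a `1`, is the finite set of the wires that carry a `1`. -/

/-- Finite complex combinations of the basis kets of the wires. -/
abbrev WireState : Type := Finset ℕ →₀ ℂ

/-- The basis ket in which exactly the wires in `x` carry a `1`. -/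
noncomputable def ket (x : Finset ℕ) : WireState := Finsupp.single x 1

/-- Elementary gates: Hadamard, `T = diag(1, exp(iπ/4))`, NOT, CNOT (control, target) and
Toffoli (control, control, target). -/
inductive Gate : Type
  | hadamard (i : ℕ)
  | phaseT (i : ℕ)
  | not (i : ℕ)
  | cnot (i j : ℕ)
  | toffoli (i j k : ℕ)

/-- Action of a gate on a basis ket. A CNOT or Toffoli gate whose target is also one of its
controls is not a legal gate and acts as the identity, so that every gate is unitary. -/
noncomputable def Gate.onKet : Gate → Finset ℕ → WireState
  | .hadamard i, x =>
      ((1 / Real.sqrt 2 : ℝ) : ℂ) •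
        (ket (x.erase i) + (if i ∈ x then (-1 : ℂ) else 1) • ket (insert i x))
  | .phaseT i, x =>
      (if i ∈ x then Complex.exp (Complex.I * (Real.pi : ℂ) / 4) else 1) • ket x
  | .not i, x => ket (symmDiff x {i})
  | .cnot i j, x => if i ≠ j ∧ i ∈ x then ket (symmDiff x {j}) else ket x
  | .toffoli i j k, x =>
      if i ≠ k ∧ j ≠ k ∧ i ∈ x ∧ j ∈ x then ket (symmDiff x {k}) else ket x

/-- A gate as a linear operator. -/
noncomputable def Gate.apply (g : Gate) : WireState →ₗ[ℂ] WireState :=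
  Finsupp.linearCombination ℂ g.onKet

/-- Run a circuit, the first gate of the list being applied first. -/
noncomputable def runCircuit (C : List Gate) (φ : WireState) : WireState :=
  C.foldl (fun φ g => g.apply φ) φ

/-- The wires that carry a `1` when `k` blocks of `n` bits are written on the wires
`0, …, k * n - 1`: bit `j` of block `i` is on wire `i * n + j`. -/
def blockWires {k n : ℕ} (x : Fin k → Fin n → Bool) : Finset ℕ :=
  (Finset.univ.filter fun q : Fin k × Fin n => x q.1 q.2 = true).image
    fun q => (q.1 : ℕ) * n + (q.2 : ℕ)

/-- The state `ψ^{⊗k}` on the wires `0, …, k * n - 1`, every other wire being in state `|0⟩`. -/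
noncomputable def copies {n : ℕ} (k : ℕ) (ψ : Qubits n) : WireState :=
  ∑ x : Fin k → Fin n → Bool, (∏ i, ψ (x i)) • ket (blockWires x)

/-- The probability that a measurement of wire `w` yields `1`. -/
noncomputable def probOne (w : ℕ) (φ : WireState) : ℝ :=
  ∑ x ∈ φ.support.filter (fun x => w ∈ x), ‖φ x‖ ^ 2

/-! ### Polynomial-time quantum algorithms

A quantum algorithm is a uniform family of quantum circuits: one fixed classical program
writes, on input `n` (the number of qubits, in unary), the gates of the `n`-th circuit one after
the other. The program has registers that hold natural numbers, and every elementary operation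
takes one time unit. In `T` time units a register never exceeds `n + T`, so a program that
runs in polynomial time uses logarithmic space besides its output, and in particular the
circuit family is polynomial-time uniform and of polynomial size. -/

/-- Circuit-writing programs. In `emit*`, the arguments are the registers that hold the indices
of the wires. -/
inductive Prog : Type
  | zero (r : ℕ)
  | inc (r : ℕ)
  | dec (r : ℕ)
  | copy (r s : ℕ)
  | emitHadamard (r : ℕ)
  | emitPhaseT (r : ℕ)
  | emitNot (r : ℕ)
  | emitCnot (r s : ℕ)
  | emitToffoli (r s t : ℕ)
  | seq (P Q : Prog)
  | ifZero (r : ℕ) (P Q : Prog)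
  | loop (r : ℕ) (P : Prog)

/-- Configurations: register contents, gates written so far, time used so far. -/
structure Config : Type where
  reg : ℕ → ℕ
  circ : List Gate
  time : ℕ

/-- Use one time unit. -/
def Config.tick (c : Config) : Config := { c with time := c.time + 1 }

/-- Write `v` into register `r`, in one time unit. -/
def Config.set (c : Config) (r v : ℕ) : Config :=
  { c.tick with reg := Function.update c.reg r v }

/-- Write the gate `g` to the output, in one time unit. -/
def Config.emit (c : Config) (g : Gate) : Config :=
  { c.tick with circ := c.circ ++ [g] }

/-- Execution. `copy r s` copies register `s` to register `r`; `loop r P` executes `P` as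
many times as the content of register `r` at the entry of the loop, with one extra time unit at
the entry and one per iteration. -/
def Prog.exec : Prog → Config → Config
  | .zero r, c => c.set r 0
  | .inc r, c => c.set r (c.reg r + 1)
  | .dec r, c => c.set r (c.reg r - 1)
  | .copy r s, c => c.set r (c.reg s)
  | .emitHadamard r, c => c.emit (.hadamard (c.reg r))
  | .emitPhaseT r, c => c.emit (.phaseT (c.reg r))
  | .emitNot r, c => c.emit (.not (c.reg r))
  | .emitCnot r s, c => c.emit (.cnot (c.reg r) (c.reg s))
  | .emitToffoli r s t, c => c.emit (.toffoli (c.reg r) (c.reg s) (c.reg t))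
  | .seq P Q, c => Q.exec (P.exec c)
  | .ifZero r P Q, c => if c.reg r = 0 then P.exec c.tick else Q.exec c.tick
  | .loop r P, c => (fun d => P.exec d.tick)^[c.reg r] c.tick

/-- The final configuration on input `n`: initially register `0` holds `n`, the other
registers hold `0`, and nothing is written. -/
def Prog.run (A : Prog) (n : ℕ) : Config :=
  A.exec ⟨fun r => if r = 0 then n else 0, [], 0⟩

/-- The program runs in polynomial time (so its circuits have polynomially many gates). -/
def Prog.PolyTime (A : Prog) : Prop :=
  ∃ q : ℕ[X], ∀ n, (A.run n).time ≤ q.eval n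

/-- The probability that the quantum algorithm `A` accepts `ψ^{⊗k}`: the circuit that the program
writes on input `n` is applied to `ψ^{⊗k}` and ancillas `|0⟩`, and then the wire whose index the
program left in register `0` is measured; `1` means acceptance. -/
noncomputable def acceptProb (A : Prog) (k : ℕ) {n : ℕ} (ψ : Qubits n) : ℝ :=
  probOne ((A.run n).reg 0) (runCircuit (A.run n).circ (copies k ψ))

/-- The probability that `A` accepts `k` copies of one Haar random state of `n` qubits. -/
noncomputable def haarAcceptProb (A : Prog) (k n : ℕ) : ℝ :=
  ∫ ψ : PureState n, acceptProb A k (ψ : Qubits n) ∂(haarState n)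

/-! ### The two tests -/

/-- Collision test: the probability that among `m` independent measurements of `ψ` in the
computational basis two have the same outcome. -/
noncomputable def collisionProb {n : ℕ} (m : ℕ) (ψ : Qubits n) : ℝ :=
  open Classical in
  ∑ x ∈ Finset.univ.filter (fun x : Fin m → Fin n → Bool => ¬ Function.Injective x),
    ∏ i, ‖ψ (x i)‖ ^ 2

/-- The probability `(1 + |⟨u|ψ⟩|²) / 2` that the swap test of `ψ` and the uniform
superposition `u = 2^(-n/2) ∑_x |x⟩` outputs "equal". -/
noncomputable def swapTestProb {n : ℕ} (ψ : Qubits n) : ℝ :=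
  (1 + ‖inner ℂ (subsetState (Finset.univ : Finset (Fin n → Bool))) ψ‖ ^ 2) / 2

/-- The probability that at least `t` of `k` independent trials succeed, each with
probability `q`. -/
noncomputable def atLeastProb (k t : ℕ) (q : ℝ) : ℝ :=
  ∑ j ∈ Finset.Icc t k, (k.choose j : ℝ) * q ^ j * (1 - q) ^ (k - j)

/-! ### Writing programs -/

/-! Small sets. Measuring `s + 1` copies of a state supported on `s` strings must produce a
repetition, by the pigeonhole principle (`collisionProb_subsetState`). For a Haar state, the union
bound over pairs of measurements bounds the collision probability by `m² ∑ |ψ_a|⁴`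
(`collisionProb_le`), and `E |ψ_a|⁴ ≤ 3 / 4^n` (`integral_norm_pow_four_le`), so the mean is at most
`3 m² / 2^n`. The moments need only the invariance of the Haar measure under reflections: any two
vectors of equal norm are exchanged by one, so the moments of a real inner product depend only on
the norm of the vector (`integral_inner_pow_eq`), and the normalization of `ψ` fixes their size.

Large sets. The squared overlap with `u` is `|S| / 2^n`, about `1 / p(n)`, for a subset state, and
has mean `2^(-n)` for a Haar state. The success probabilities of one swap test therefore differ by
about `1 / (2 p(n))`, which order `p(n)²` repetitions and Chebyshev's inequality amplify to a
constant gap (`le_atLeastProb_subsetState`, `integral_atLeastProb_le`). No controlled swap is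
performed: Hadamard gates on a copy turn its overlap with `u` into the amplitude of the zero string,
and the disjunction of "the measured string is zero" with a fair coin has exactly the swap test
probability (`acceptProb_eq_atLeastProb`).

Circuits. Apart from one initial layer of Hadamard gates in the second algorithm, both circuits are
classical and reversible, so they permute kets and the acceptance probability is the mass of the
accepted kets. Over `ZMod 2` a reversible gate adds the product of its controls to its target. If no
gate changes a control of an earlier gate, the final bits solve a system of equations
(`WellOrdered.wireBit_circuitAct`), which replaces any step-by-step simulation. Uniformity follows
because `RegComputable` is closed under arithmetic and `Writes` under concatenation and `for` loops,
so that a program is obtained by following the formula of the circuit. -/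

/-- The natural-number function `f` of the first `d₀` registers can be computed into any register
`d ≥ d₀`, with the registers below `d` unchanged, in time polynomial in the first `d₀`
registers. -/
def RegComputable (d₀ : ℕ) (f : (ℕ → ℕ) → ℕ) : Prop :=
  (∀ r r', (∀ i < d₀, r i = r' i) → f r = f r') ∧
  (∃ q : ℕ[X], ∀ r M, (∀ i < d₀, r i ≤ M) → f r ≤ q.eval M) ∧
  ∀ d ≥ d₀, ∃ (P : Prog) (q : ℕ[X]), ∀ c : Config,
    (∀ i < d, (P.exec c).reg i = c.reg i) ∧ (P.exec c).reg d = f c.reg ∧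
    (P.exec c).circ = c.circ ∧
    ∀ M, (∀ i < d₀, c.reg i ≤ M) → (P.exec c).time ≤ c.time + q.eval M

/-- The gate list `g`, a function of the first `d₀` registers, can be written with these
registers unchanged, in time polynomial in them. -/
def Writes (d₀ : ℕ) (g : (ℕ → ℕ) → List Gate) : Prop :=
  (∀ r r', (∀ i < d₀, r i = r' i) → g r = g r') ∧
  ∃ (P : Prog) (q : ℕ[X]), ∀ c : Config,
    (∀ i < d₀, (P.exec c).reg i = c.reg i) ∧ (P.exec c).circ = c.circ ++ g c.reg ∧
    ∀ M, (∀ i < d₀, c.reg i ≤ M) → (P.exec c).time ≤ c.time + q.eval M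

/-- The body of a program loop is an iterated function. The invariant carries the iteration number,
which lets it record exact register contents and elapsed time. -/
theorem iterate_invariant {α : Type*} {F : α → α} {I : ℕ → α → Prop} {N : ℕ} {c : α}
    (h0 : I 0 c) (hs : ∀ k < N, ∀ e, I k e → I (k + 1) (F e)) : I N (F^[N] c) := by
  suffices h : ∀ k ≤ N, I k (F^[k] c) from h N le_rfl
  intro k
  induction k with
  | zero => intro; simpa
  | succ k ih =>
    intro hk
    rw [Function.iterate_succ_apply']
    exact hs k hk _ (ih (by lia))

namespace RegComputable

variable {d₀ : ℕ} {f g : (ℕ → ℕ) → ℕ}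

theorem weaken {d₁ : ℕ} (hf : RegComputable d₀ f) (h : d₀ ≤ d₁) : RegComputable d₁ f := by
  obtain ⟨h1, ⟨q, hq⟩, h3⟩ := hf
  refine ⟨fun r r' hr => h1 r r' fun i hi => hr i (by lia),
    ⟨q, fun r M hr => hq r M fun i hi => hr i (by lia)⟩, fun d hd => ?_⟩
  obtain ⟨P, q, hP⟩ := h3 d (by lia)
  refine ⟨P, q, fun c => ?_⟩
  obtain ⟨a1, a2, a3, a4⟩ := hP c
  exact ⟨a1, a2, a3, fun M hM => a4 M fun i hi => hM i (by lia)⟩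

theorem var {i : ℕ} (h : i < d₀) : RegComputable d₀ fun r => r i := by
  refine ⟨fun r r' hr => hr i h, ⟨X, fun r M hr => by simpa using hr i h⟩, fun d hd => ?_⟩
  refine ⟨.copy d i, 1, fun c => ⟨fun j hj => ?_, ?_, ?_, fun M _ => ?_⟩⟩
  · simp [Prog.exec, Config.set, hj.ne]
  · simp [Prog.exec, Config.set]
  · simp [Prog.exec, Config.set, Config.tick]
  · simp [Prog.exec, Config.set, Config.tick]

theorem const (d₀ k : ℕ) : RegComputable d₀ fun _ => k := by
  refine ⟨fun _ _ _ => rfl, ⟨C k, fun r M hr => by simp⟩, fun d hd => ?_⟩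
  induction k with
  | zero =>
    refine ⟨.zero d, 1, fun c => ⟨fun j hj => ?_, ?_, ?_, fun M _ => ?_⟩⟩
    · simp [Prog.exec, Config.set, hj.ne]
    · simp [Prog.exec, Config.set]
    · simp [Prog.exec, Config.set, Config.tick]
    · simp [Prog.exec, Config.set, Config.tick]
  | succ k ih =>
    obtain ⟨P, q, hP⟩ := ih
    refine ⟨.seq P (.inc d), q + 1, fun c => ?_⟩
    obtain ⟨a1, a2, a3, a4⟩ := hP c
    refine ⟨fun j hj => ?_, ?_, ?_, fun M hM => ?_⟩
    · simp [Prog.exec, Config.set, hj.ne, a1 j hj]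
    · simp [Prog.exec, Config.set, a2]
    · simp [Prog.exec, Config.set, Config.tick, a3]
    · have := a4 M hM
      simp [Prog.exec, Config.set, Config.tick]
      lia

/-- Compute two values in the registers `d` and `d + 1`. -/
theorem pair (hf : RegComputable d₀ f) (hg : RegComputable d₀ g) (d : ℕ) (hd : d₀ ≤ d) :
    ∃ (P : Prog) (q : ℕ[X]), ∀ c : Config,
      (∀ i < d, (P.exec c).reg i = c.reg i) ∧ (P.exec c).reg d = f c.reg ∧
      (P.exec c).reg (d + 1) = g c.reg ∧ (P.exec c).circ = c.circ ∧
      ∀ M, (∀ i < d₀, c.reg i ≤ M) → (P.exec c).time ≤ c.time + q.eval M := by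
  obtain ⟨-, -, hf3⟩ := hf
  obtain ⟨hg1, -, hg3⟩ := hg
  obtain ⟨P, q, hP⟩ := hf3 d hd
  obtain ⟨Q, q', hQ⟩ := hg3 (d + 1) (by lia)
  refine ⟨.seq P Q, q + q', fun c => ?_⟩
  obtain ⟨a1, a2, a3, a4⟩ := hP c
  obtain ⟨b1, b2, b3, b4⟩ := hQ (P.exec c)
  refine ⟨fun i hi => ?_, ?_, ?_, ?_, fun M hM => ?_⟩
  · simp only [Prog.exec]
    rw [b1 i (by lia), a1 i hi]
  · simp only [Prog.exec]
    rw [b1 d (by lia), a2]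
  · simp only [Prog.exec]
    rw [b2]
    exact hg1 _ _ fun i hi => a1 i (by lia)
  · simp only [Prog.exec]
    rw [b3, a3]
  · have h1 := a4 M hM
    have h2 := b4 M fun i hi => by rw [a1 i (by lia)]; exact hM i hi
    simp only [Prog.exec, eval_add]
    lia

theorem add (hf : RegComputable d₀ f) (hg : RegComputable d₀ g) :
    RegComputable d₀ fun r => f r + g r := by
  have hpair := hf.pair hg
  obtain ⟨hf1, ⟨qf, hqf⟩, -⟩ := hf
  obtain ⟨hg1, ⟨qg, hqg⟩, -⟩ := hg
  refine ⟨fun r r' h => by simp only [hf1 r r' h, hg1 r r' h],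
    ⟨qf + qg, fun r M h => by simpa using add_le_add (hqf r M h) (hqg r M h)⟩, fun d hd => ?_⟩
  obtain ⟨P, q, hP⟩ := hpair d hd
  refine ⟨.seq P (.loop (d + 1) (.inc d)), q + 1 + 2 * qg, fun c => ?_⟩
  obtain ⟨a1, a2, a3, a4, a5⟩ := hP c
  simp only [Prog.exec]
  have key := iterate_invariant (F := fun e : Config => e.tick.set d (e.tick.reg d + 1))
    (N := (P.exec c).reg (d + 1)) (c := (P.exec c).tick)
    (I := fun k e => (∀ i < d, e.reg i = c.reg i) ∧ e.reg d = f c.reg + k ∧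
      e.circ = c.circ ∧ e.time = (P.exec c).time + 1 + 2 * k)
    ⟨a1, by simp [Config.tick, a2], a4, by simp [Config.tick]⟩ (by
      rintro k - e ⟨b1, b2, b3, b4⟩
      refine ⟨fun i hi => ?_, ?_, ?_, ?_⟩
      · simp [Config.set, Config.tick, hi.ne, b1 i hi]
      · simp [Config.set, Config.tick, b2]; lia
      · simp [Config.set, Config.tick, b3]
      · simp [Config.set, Config.tick, b4]; lia)
  obtain ⟨b1, b2, b3, b4⟩ := key
  refine ⟨b1, by rw [b2, a3], b3, fun M hM => ?_⟩
  rw [b4, a3]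
  have := a5 M hM
  have := hqg c.reg M hM
  simp
  lia

theorem sub (hf : RegComputable d₀ f) (hg : RegComputable d₀ g) :
    RegComputable d₀ fun r => f r - g r := by
  have hpair := hf.pair hg
  obtain ⟨hf1, ⟨qf, hqf⟩, -⟩ := hf
  obtain ⟨hg1, ⟨qg, hqg⟩, -⟩ := hg
  refine ⟨fun r r' h => by simp only [hf1 r r' h, hg1 r r' h],
    ⟨qf, fun r M h => (Nat.sub_le _ _).trans (hqf r M h)⟩, fun d hd => ?_⟩
  obtain ⟨P, q, hP⟩ := hpair d hd
  refine ⟨.seq P (.loop (d + 1) (.dec d)), q + 1 + 2 * qg, fun c => ?_⟩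
  obtain ⟨a1, a2, a3, a4, a5⟩ := hP c
  simp only [Prog.exec]
  have key := iterate_invariant (F := fun e : Config => e.tick.set d (e.tick.reg d - 1))
    (N := (P.exec c).reg (d + 1)) (c := (P.exec c).tick)
    (I := fun k e => (∀ i < d, e.reg i = c.reg i) ∧ e.reg d = f c.reg - k ∧
      e.circ = c.circ ∧ e.time = (P.exec c).time + 1 + 2 * k)
    ⟨a1, by simp [Config.tick, a2], a4, by simp [Config.tick]⟩ (by
      rintro k - e ⟨b1, b2, b3, b4⟩
      refine ⟨fun i hi => ?_, ?_, ?_, ?_⟩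
      · simp [Config.set, Config.tick, hi.ne, b1 i hi]
      · simp [Config.set, Config.tick, b2]; lia
      · simp [Config.set, Config.tick, b3]
      · simp [Config.set, Config.tick, b4]; lia)
  obtain ⟨b1, b2, b3, b4⟩ := key
  refine ⟨b1, by rw [b2, a3], b3, fun M hM => ?_⟩
  rw [b4, a3]
  have := a5 M hM
  have := hqg c.reg M hM
  simp
  lia

theorem mul (hf : RegComputable d₀ f) (hg : RegComputable d₀ g) :
    RegComputable d₀ fun r => f r * g r := by
  have hpair := hf.pair hg
  obtain ⟨hf1, ⟨qf, hqf⟩, -⟩ := hf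
  obtain ⟨hg1, ⟨qg, hqg⟩, -⟩ := hg
  refine ⟨fun r r' h => by simp only [hf1 r r' h, hg1 r r' h],
    ⟨qf * qg, fun r M h => by simpa using Nat.mul_le_mul (hqf r M h) (hqg r M h)⟩,
    fun d hd => ?_⟩
  -- The factors go to `d + 1` and `d + 2`, since `d` accumulates the product by repeated
  -- increments.
  obtain ⟨P, q, hP⟩ := hpair (d + 1) (by lia)
  refine ⟨.seq P (.seq (.zero d) (.loop (d + 1) (.loop (d + 2) (.inc d)))),
    q + 2 + qf * (2 * qg + 2), fun c => ?_⟩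
  obtain ⟨a1, a2, a3, a4, a5⟩ := hP c
  simp only [Prog.exec]
  have inner : ∀ e₀ : Config, ∀ N, let e' := (fun e : Config =>
      e.tick.set d (e.tick.reg d + 1))^[N] e₀
      (∀ i ≠ d, e'.reg i = e₀.reg i) ∧ e'.reg d = e₀.reg d + N ∧ e'.circ = e₀.circ ∧
      e'.time = e₀.time + 2 * N := by
    intro e₀ N
    refine iterate_invariant (I := fun k (e : Config) => (∀ i ≠ d, e.reg i = e₀.reg i) ∧
      e.reg d = e₀.reg d + k ∧ e.circ = e₀.circ ∧ e.time = e₀.time + 2 * k)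
      ⟨fun _ _ => rfl, rfl, rfl, rfl⟩ ?_
    rintro k - e ⟨b1, b2, b3, b4⟩
    refine ⟨fun i hi => ?_, ?_, ?_, ?_⟩
    · simp [Config.set, Config.tick, hi, b1 i hi]
    · simp [Config.set, Config.tick, b2]; lia
    · simp [Config.set, Config.tick, b3]
    · simp [Config.set, Config.tick, b4]; lia
  have key := iterate_invariant
    (F := fun e : Config => (fun e : Config => e.tick.set d (e.tick.reg d + 1))^[e.tick.reg (d + 2)]
      e.tick.tick)
    (N := ((P.exec c).set d 0).reg (d + 1)) (c := ((P.exec c).set d 0).tick)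
    (I := fun k e => (∀ i < d, e.reg i = c.reg i) ∧ e.reg d = k * g c.reg ∧
      e.reg (d + 2) = g c.reg ∧
      e.circ = c.circ ∧ e.time = (P.exec c).time + 2 + k * (2 * g c.reg + 2))
    ⟨fun i hi => by simp [Config.tick, Config.set, hi.ne, a1 i (Nat.lt_succ_of_lt hi)],
      by simp [Config.tick, Config.set], by simpa [Config.tick, Config.set] using a3,
      by simpa [Config.tick, Config.set] using a4, by simp [Config.tick, Config.set]⟩ (by
      rintro k - e ⟨b1, b2, b3, b4, b5⟩
      obtain ⟨e1, e2, e3, e4⟩ := inner e.tick.tick (e.tick.reg (d + 2))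
      refine ⟨fun i hi => ?_, ?_, ?_, ?_, ?_⟩
      · rw [e1 i hi.ne]; exact b1 i hi
      · rw [e2]; simp only [Config.tick]; rw [b2, b3]; ring
      · rw [e1 _ (by lia)]; exact b3
      · rw [e3]; exact b4
      · rw [e4]; simp only [Config.tick]; rw [b5, b3]; ring)
  obtain ⟨b1, b2, b3, b4, b5⟩ := key
  have hd1 : ((P.exec c).set d 0).reg (d + 1) = f c.reg := by simpa [Config.set] using a2
  refine ⟨b1, by rw [b2, hd1], b4, fun M hM => ?_⟩
  rw [b5, hd1]
  have h1 := a5 M hM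
  have h2 := hqg c.reg M hM
  have h3 := hqf c.reg M hM
  have : f c.reg * (2 * g c.reg + 2) ≤ qf.eval M * (2 * qg.eval M + 2) := by gcongr
  simp
  lia

theorem exists_prog_sub_const (d k : ℕ) : ∃ P : Prog, ∀ c : Config,
    (P.exec c).reg = Function.update c.reg d (c.reg d - k) ∧
      (P.exec c).circ = c.circ ∧ (P.exec c).time = c.time + k + 1 := by
  induction k with
  | zero =>
    refine ⟨.copy d d, fun c => ⟨?_, ?_, ?_⟩⟩ <;> simp [Prog.exec, Config.set, Config.tick]
  | succ k ih =>
    obtain ⟨P, hP⟩ := ih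
    refine ⟨.seq P (.dec d), fun c => ⟨?_, ?_, ?_⟩⟩
    · simp [Prog.exec, Config.set, hP c]; lia
    · simp [Prog.exec, Config.set, Config.tick, hP c]
    · simp [Prog.exec, Config.set, Config.tick, hP c]; lia

/-- Counting up to `f` with a quotient in `d` and a remainder in `d + 2`. Register `d + 3` tests for
overflow: the truncated difference of the increased remainder and `D - 1` is zero exactly while that
remainder is below `D`. As `D` is fixed, the subtraction is unrolled into the program. -/
theorem div_const (hf : RegComputable d₀ f) {D : ℕ} (hD : 0 < D) :
    RegComputable d₀ fun r => f r / D := by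
  obtain ⟨hf1, ⟨qf, hqf⟩, hf3⟩ := hf
  refine ⟨fun r r' h => by simp only [hf1 r r' h],
    ⟨qf, fun r M h => (Nat.div_le_self _ _).trans (hqf r M h)⟩, fun d hd => ?_⟩
  obtain ⟨P, q, hP⟩ := hf3 (d + 1) (by lia)
  obtain ⟨Q, hQ⟩ := exists_prog_sub_const (d + 3) (D - 1)
  set body : Prog := .seq (.inc (d + 2)) (.seq (.copy (d + 3) (d + 2)) (.seq Q
    (.ifZero (d + 3) (.copy d d) (.seq (.zero (d + 2)) (.inc d))))) with hbody
  refine ⟨.seq P (.seq (.zero d) (.seq (.zero (d + 2)) (.loop (d + 1) body))),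
    q + 3 + qf * C (D + 10), fun c => ?_⟩
  obtain ⟨a1, a2, a3, a4⟩ := hP c
  have hexec : ∀ e : Config,
      ((body.exec e).reg = if e.reg (d + 2) + 1 < D then
        Function.update (Function.update e.reg (d + 2) (e.reg (d + 2) + 1)) (d + 3)
          (e.reg (d + 2) + 1 - (D - 1))
        else Function.update (Function.update (Function.update (Function.update e.reg (d + 2)
          (e.reg (d + 2) + 1)) (d + 3) (e.reg (d + 2) + 1 - (D - 1))) (d + 2) 0) d
          (e.reg d + 1)) ∧
      (body.exec e).circ = e.circ ∧ (body.exec e).time ≤ e.time + D + 5 := by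
    intro e
    obtain ⟨q1, q2, q3⟩ := hQ (((e.set (d + 2) (e.reg (d + 2) + 1))).set (d + 3)
      (e.reg (d + 2) + 1))
    have hreg : (e.set (d + 2) (e.reg (d + 2) + 1)).reg (d + 2) = e.reg (d + 2) + 1 := by
      simp [Config.set]
    simp only [hbody, Prog.exec, hreg]
    generalize Q.exec _ = e' at q1 q2 q3 ⊢
    have hz : e'.reg (d + 3) = 0 ↔ e.reg (d + 2) + 1 < D := by
      simp [q1, Config.set]; lia
    simp only [hz]
    split_ifs with h
    · refine ⟨?_, ?_, ?_⟩
      · simp [Config.set, Config.tick, q1]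
      · simp [Config.set, Config.tick, q2]
      · simp [Config.set, Config.tick, q3]; lia
    · refine ⟨?_, ?_, ?_⟩
      · simp [Config.set, Config.tick, q1]
      · simp [Config.set, Config.tick, q2]
      · simp [Config.set, Config.tick, q3]; lia
  set c₀ := ((P.exec c).set d 0).set (d + 2) 0 with hc₀
  have hc1 : c₀.reg (d + 1) = f c.reg := by simpa [hc₀, Config.set] using a2
  have key := iterate_invariant (F := fun e : Config => body.exec e.tick)
    (N := c₀.reg (d + 1)) (c := c₀.tick)
    (I := fun k e => (∀ i < d, e.reg i = c.reg i) ∧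
      (e.reg d * D + e.reg (d + 2) = k ∧ e.reg (d + 2) < D) ∧
      e.circ = c.circ ∧ e.time ≤ (P.exec c).time + 3 + k * (D + 10))
    ⟨fun i hi => by
        simp [hc₀, Config.tick, Config.set, hi.ne, (show i ≠ d + 2 by lia),
          a1 i (Nat.lt_succ_of_lt hi)],
      by simp [hc₀, Config.tick, Config.set, hD], by simp [hc₀, Config.tick, Config.set, a3],
      by simp [hc₀, Config.tick, Config.set]⟩ (by
      rintro k - e ⟨b1, ⟨b2, b2'⟩, b3, b4⟩
      obtain ⟨e1, e2, e3⟩ := hexec e.tick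
      have ht : e.tick.reg = e.reg := rfl
      have ht' : e.tick.time = e.time + 1 := rfl
      rw [ht] at e1
      refine ⟨fun i hi => ?_, ?_, ?_, ?_⟩
      · rw [e1, ← b1 i hi]
        split_ifs <;> simp [hi.ne, (show i ≠ d + 2 by lia), (show i ≠ d + 3 by lia)]
      · rw [e1]
        split_ifs with h
        · simp
          lia
        · simp
          have : e.reg (d + 2) + 1 = D := by lia
          refine ⟨?_, hD⟩
          rw [add_mul, one_mul]
          lia
      · rw [e2]; exact b3
      · rw [ht'] at e3
        rw [add_mul]
        lia)
  obtain ⟨b1, ⟨b2, b2'⟩, b3, b4⟩ := key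
  have hfin : Prog.exec (.seq P (.seq (.zero d) (.seq (.zero (d + 2)) (.loop (d + 1) body)))) c =
    (fun e : Config => body.exec e.tick)^[c₀.reg (d + 1)] c₀.tick := rfl
  rw [hfin]
  rw [hc1] at *
  refine ⟨b1, ?_, b3, fun M hM => ?_⟩
  · change (_ : ℕ) = f c.reg / D
    exact (Nat.div_eq_of_lt_le (by omega) (by rw [add_mul]; omega)).symm
  · refine b4.trans ?_
    have h1 := a4 M hM
    have h3 := hqf c.reg M hM
    have : f c.reg * (D + 10) ≤ qf.eval M * (D + 10) := by gcongr
    simp only [eval_add, eval_mul, eval_C, eval_ofNat]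
    lia

theorem pow_const (hf : RegComputable d₀ f) (k : ℕ) : RegComputable d₀ fun r => f r ^ k := by
  induction k with
  | zero => simpa using const d₀ 1
  | succ k ih => simpa [pow_succ] using ih.mul hf

theorem polynomial_eval (hf : RegComputable d₀ f) (q : ℕ[X]) :
    RegComputable d₀ fun r => q.eval (f r) := by
  induction q using Polynomial.induction_on' with
  | add p q hp hq => simpa using hp.add hq
  | monomial k a => simpa using (const d₀ a).mul (hf.pow_const k)

end RegComputable

namespace Writes

variable {d₀ : ℕ} {g h : (ℕ → ℕ) → List Gate} {a b c : (ℕ → ℕ) → ℕ}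

theorem append (hg : Writes d₀ g) (hh : Writes d₀ h) : Writes d₀ fun r => g r ++ h r := by
  obtain ⟨hg1, P, q, hP⟩ := hg
  obtain ⟨hh1, Q, q', hQ⟩ := hh
  refine ⟨fun r r' hr => by simp only [hg1 r r' hr, hh1 r r' hr], .seq P Q, q + q', fun c => ?_⟩
  obtain ⟨a1, a2, a3⟩ := hP c
  obtain ⟨b1, b2, b3⟩ := hQ (P.exec c)
  simp only [Prog.exec]
  refine ⟨fun i hi => by rw [b1 i hi, a1 i hi], ?_, fun M hM => ?_⟩
  · rw [b2, a2, hh1 _ _ a1, List.append_assoc]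
  · have h1 := a3 M hM
    have h2 := b3 M fun i hi => by rw [a1 i hi]; exact hM i hi
    simp
    lia

theorem not (ha : RegComputable d₀ a) : Writes d₀ fun r => [.not (a r)] := by
  obtain ⟨h1, -, h3⟩ := ha
  obtain ⟨P, q, hP⟩ := h3 d₀ le_rfl
  refine ⟨fun r r' hr => by simp only [h1 r r' hr], .seq P (.emitNot d₀), q + 1, fun c => ?_⟩
  obtain ⟨a1, a2, a3, a4⟩ := hP c
  refine ⟨fun i hi => a1 i hi, ?_, fun M hM => ?_⟩
  · simp [Prog.exec, Config.emit, Config.tick, a2, a3]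
  · have := a4 M hM
    simp [Prog.exec, Config.emit, Config.tick]
    lia

theorem hadamard (ha : RegComputable d₀ a) : Writes d₀ fun r => [.hadamard (a r)] := by
  obtain ⟨h1, -, h3⟩ := ha
  obtain ⟨P, q, hP⟩ := h3 d₀ le_rfl
  refine ⟨fun r r' hr => by simp only [h1 r r' hr], .seq P (.emitHadamard d₀), q + 1, fun c => ?_⟩
  obtain ⟨a1, a2, a3, a4⟩ := hP c
  refine ⟨fun i hi => a1 i hi, ?_, fun M hM => ?_⟩
  · simp [Prog.exec, Config.emit, Config.tick, a2, a3]
  · have := a4 M hM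
    simp [Prog.exec, Config.emit, Config.tick]
    lia

theorem cnot (ha : RegComputable d₀ a) (hb : RegComputable d₀ b) :
    Writes d₀ fun r => [.cnot (a r) (b r)] := by
  obtain ⟨P, q, hP⟩ := ha.pair hb d₀ le_rfl
  refine ⟨fun r r' hr => by simp only [ha.1 r r' hr, hb.1 r r' hr],
    .seq P (.emitCnot d₀ (d₀ + 1)), q + 1, fun c => ?_⟩
  obtain ⟨a1, a2, a3, a4, a5⟩ := hP c
  refine ⟨fun i hi => a1 i hi, ?_, fun M hM => ?_⟩
  · simp [Prog.exec, Config.emit, Config.tick, a2, a3, a4]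
  · have := a5 M hM
    simp [Prog.exec, Config.emit, Config.tick]
    lia

theorem toffoli (ha : RegComputable d₀ a) (hb : RegComputable d₀ b) (hc : RegComputable d₀ c) :
    Writes d₀ fun r => [.toffoli (a r) (b r) (c r)] := by
  obtain ⟨P, q, hP⟩ := ha.pair hb d₀ le_rfl
  obtain ⟨-, -, hc3⟩ := id hc
  obtain ⟨Q, q', hQ⟩ := hc3 (d₀ + 2) (by lia)
  refine ⟨fun r r' hr => by simp only [ha.1 r r' hr, hb.1 r r' hr, hc.1 r r' hr],
    .seq P (.seq Q (.emitToffoli d₀ (d₀ + 1) (d₀ + 2))), q + q' + 1, fun e => ?_⟩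
  obtain ⟨a1, a2, a3, a4, a5⟩ := hP e
  obtain ⟨b1, b2, b3, b4⟩ := hQ (P.exec e)
  refine ⟨fun i hi => ?_, ?_, fun M hM => ?_⟩
  · simp only [Prog.exec, Config.emit, Config.tick]
    rw [b1 i (by lia), a1 i hi]
  · simp [Prog.exec, Config.emit, Config.tick, b1, b2, a2, a3, b3, a4, hc.1 _ _ a1]
  · have h1 := a5 M hM
    have h2 := b4 M fun i hi => by rw [a1 i hi]; exact hM i hi
    simp [Prog.exec, Config.emit, Config.tick]
    lia

/-- A `for` loop; the loop variable is register `d₀`. -/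
theorem loop (ha : RegComputable d₀ a) (hg : Writes (d₀ + 1) g) :
    Writes d₀ fun r => (List.range (a r)).flatMap fun i => g (Function.update r d₀ i) := by
  obtain ⟨ha1, ⟨qa, hqa⟩, ha3⟩ := ha
  obtain ⟨hg1, Q, q', hQ⟩ := hg
  -- The bound sits in `d₀ + 1`, which the body may overwrite: the number of iterations is read only
  -- at the entry. The loop variable stays below the bound, hence the body runs on registers of size
  -- at most `M + qa(M)`, which explains the composition in the time polynomial.
  obtain ⟨P, q, hP⟩ := ha3 (d₀ + 1) (by lia)
  refine ⟨fun r r' hr => ?_, .seq P (.seq (.zero d₀) (.loop (d₀ + 1) (.seq Q (.inc d₀)))),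
    q + 2 + qa * (q'.comp (X + qa) + 2), fun c => ?_⟩
  · simp only [ha1 r r' hr]
    congr 1
    ext1 i
    refine hg1 _ _ fun j hj => ?_
    rcases eq_or_ne j d₀ with rfl | hj'
    · simp
    · simp [hj', hr j (by lia)]
  obtain ⟨a1, a2, a3, a4⟩ := hP c
  simp only [Prog.exec]
  set c₀ := (P.exec c).set d₀ 0 with hc₀
  have hc1 : c₀.reg (d₀ + 1) = a c.reg := by simpa [hc₀, Config.set] using a2
  rw [hc1]
  have key := iterate_invariant
    (F := fun e : Config => (Q.exec e.tick).set d₀ ((Q.exec e.tick).reg d₀ + 1))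
    (N := a c.reg) (c := c₀.tick)
    (I := fun k e => (∀ i < d₀, e.reg i = c.reg i) ∧ e.reg d₀ = k ∧
      e.circ = c.circ ++ (List.range k).flatMap (fun i => g (Function.update c.reg d₀ i)) ∧
      ∀ M, (∀ i < d₀, c.reg i ≤ M) →
        e.time ≤ (P.exec c).time + 2 + k * (q'.eval (M + qa.eval M) + 2))
    ⟨fun i hi => by
        simp [hc₀, Config.tick, Config.set, hi.ne, a1 i (Nat.lt_succ_of_lt hi)],
      by simp [hc₀, Config.tick, Config.set], by simp [hc₀, Config.tick, Config.set, a3],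
      by simp [hc₀, Config.tick, Config.set]⟩ (by
      rintro k hk e ⟨b1, b2, b3, b4⟩
      obtain ⟨e1, e2, e3⟩ := hQ e.tick
      have ht : e.tick.reg = e.reg := rfl
      have ht' : e.tick.time = e.time + 1 := rfl
      have hc' : e.tick.circ = e.circ := rfl
      rw [ht] at e1 e2 e3
      refine ⟨fun i hi => ?_, ?_, ?_, fun M hM => ?_⟩
      · simp [Config.set, hi.ne, e1 i (Nat.lt_succ_of_lt hi), b1 i hi]
      · simp [Config.set, e1 d₀ (Nat.lt_succ_self _), b2]
      · have : g e.reg = g (Function.update c.reg d₀ k) := by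
          refine hg1 _ _ fun j hj => ?_
          rcases eq_or_ne j d₀ with rfl | hj'
          · simp [b2]
          · simp [hj', b1 j (by lia)]
        simp only [Config.set, Config.tick] at e2 ⊢
        rw [e2, b3, this]
        simp [List.range_succ]
      · have h1 := b4 M hM
        have hkM := hk.trans_le (hqa c.reg M hM)
        have h2 := e3 (M + qa.eval M) fun i hi => by
          rcases eq_or_ne i d₀ with rfl | hi'
          · rw [b2]; lia
          · rw [b1 i (by lia)]; exact (hM i (by lia)).trans (by lia)
        rw [ht'] at h2
        change (Q.exec e.tick).time + 1 ≤ _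
        rw [add_mul]
        lia)
  obtain ⟨b1, b2, b3, b4⟩ := key
  refine ⟨b1, b3, fun M hM => (b4 M hM).trans ?_⟩
  have h1 := a4 M hM
  have h3 := hqa c.reg M hM
  have : a c.reg * (q'.eval (M + qa.eval M) + 2) ≤
    qa.eval M * (q'.eval (M + qa.eval M) + 2) := by gcongr
  simp only [eval_add, eval_mul, eval_comp, eval_X, eval_ofNat]
  lia

theorem congr (hg : Writes d₀ g) (hgh : ∀ r, g r = h r) : Writes d₀ h := by
  rwa [← funext hgh]

/-- The gate list `g n` and the number `f n` are produced by a polynomial-time program. -/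
theorem exists_polyTime (hg : Writes 1 g) (ha : RegComputable 1 a) :
    ∃ A : Prog, A.PolyTime ∧ ∀ n, (A.run n).circ = g (fun _ => n) ∧
      (A.run n).reg 0 = a (fun _ => n) := by
  obtain ⟨hg1, P, q, hP⟩ := hg
  obtain ⟨ha1, -, ha3⟩ := ha
  obtain ⟨Q, q', hQ⟩ := ha3 1 le_rfl
  have hr : ∀ n i, i < 1 → (fun r => if r = 0 then n else 0) i = (fun _ : ℕ => n) i := by
    intro n i hi; simp [Nat.lt_one_iff.1 hi]
  refine ⟨.seq P (.seq Q (.copy 0 1)), ⟨q + q' + 1, fun n => ?_⟩, fun n => ?_⟩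
  all_goals
    obtain ⟨a1, a2, a3⟩ := hP ⟨fun r => if r = 0 then n else 0, [], 0⟩
    obtain ⟨b1, b2, b3, b4⟩ := hQ (P.exec ⟨fun r => if r = 0 then n else 0, [], 0⟩)
    have h0 := a1 0 one_pos
    simp only [if_true] at h0
  · have h1 := a3 n fun i hi => (hr n i hi).le
    have h2 := b4 n fun i hi => by rw [a1 i hi]; exact (hr n i hi).le
    simp only [Prog.run, Prog.exec, Config.set, Config.tick, eval_add, eval_one]
    simp only at h1
    lia
  · simp only [Prog.run, Prog.exec, Config.set, Config.tick]
    refine ⟨?_, ?_⟩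
    · rw [b3, a2, hg1 _ _ (hr n)]; simp
    · simp only [Function.update_self]
      rw [b2]
      exact ha1 _ _ fun i hi => by rw [a1 i hi]; exact hr n i hi

end Writes

/-! ### Linear evaluation of circuits and measurement -/

theorem runCircuit_nil (φ : WireState) : runCircuit [] φ = φ := rfl

theorem runCircuit_cons (g : Gate) (C : List Gate) (φ : WireState) :
    runCircuit (g :: C) φ = runCircuit C (g.apply φ) := rfl

theorem runCircuit_append (C C' : List Gate) (φ : WireState) :
    runCircuit (C ++ C') φ = runCircuit C' (runCircuit C φ) := by
  simp [runCircuit]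

theorem runCircuit_sum_smul {ι : Type*} (s : Finset ι) (C : List Gate) (a : ι → ℂ)
    (φ : ι → WireState) :
    runCircuit C (∑ i ∈ s, a i • φ i) = ∑ i ∈ s, a i • runCircuit C (φ i) := by
  induction C generalizing φ with
  | nil => rfl
  | cons g C ih =>
    simp only [runCircuit_cons]
    rw [← ih]
    simp

theorem Gate.apply_ket (g : Gate) (x : Finset ℕ) : g.apply (ket x) = g.onKet x := by
  simp [Gate.apply, ket]

/-- Injectivity of `h` excludes interference: every ket receives at most one amplitude. -/
theorem probOne_sum_ket {ι : Type*} [Fintype ι] (w : ℕ) (a : ι → ℂ) (h : ι → Finset ℕ)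
    (hh : Function.Injective h) :
    probOne w (∑ i, a i • ket (h i)) = ∑ i, if w ∈ h i then ‖a i‖ ^ 2 else 0 := by
  classical
  set φ := ∑ i, a i • ket (h i) with hφ
  have hval : ∀ x, φ x = ∑ i, if h i = x then a i else 0 := by
    intro x
    rw [hφ, Finsupp.finsetSum_apply]
    refine Finset.sum_congr rfl fun i _ => ?_
    simp [ket, Finsupp.single_apply]
  have hval' : ∀ i, φ (h i) = a i := by
    intro i
    rw [hval]
    simp [hh.eq_iff]
  have hsupp : φ.support ⊆ Finset.univ.image h := by
    intro x hx
    by_contra hne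
    refine Finsupp.mem_support_iff.1 hx ?_
    rw [hval]
    refine Finset.sum_eq_zero fun i _ => if_neg fun hi => hne ?_
    exact Finset.mem_image.2 ⟨i, Finset.mem_univ _, hi⟩
  rw [probOne, Finset.sum_filter, Finset.sum_subset hsupp, Finset.sum_image hh.injOn]
  · simp [hval']
  · intro x _ hx
    simp [Finsupp.notMem_support_iff.1 hx]

/-! ### Classical reversible circuits -/

/-- The wire changed by a gate. -/
def Gate.target : Gate → ℕ
  | .hadamard i => i
  | .phaseT i => i
  | .not i => i
  | .cnot _ j => j
  | .toffoli _ _ k => k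

/-- The wires that control a gate. -/
def Gate.controls : Gate → List ℕ
  | .cnot i _ => [i]
  | .toffoli i j _ => [i, j]
  | _ => []

/-- A NOT, CNOT or Toffoli gate whose target is not one of its controls. -/
def Gate.Reversible : Gate → Prop
  | .hadamard _ => False
  | .phaseT _ => False
  | .not _ => True
  | .cnot i j => i ≠ j
  | .toffoli i j k => i ≠ k ∧ j ≠ k

/-- The action of a reversible gate on bit assignments. -/
def Gate.act : Gate → Finset ℕ → Finset ℕ
  | .hadamard _, x => x
  | .phaseT _, x => x
  | .not i, x => symmDiff x {i}
  | .cnot i j, x => if i ∈ x then symmDiff x {j} else x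
  | .toffoli i j k, x => if i ∈ x ∧ j ∈ x then symmDiff x {k} else x

/-- The action of a list of reversible gates on bit assignments. -/
def circuitAct (C : List Gate) (x : Finset ℕ) : Finset ℕ := C.foldl (fun x g => g.act x) x

/-- The bit on wire `w`. -/
def wireBit (x : Finset ℕ) (w : ℕ) : ZMod 2 := if w ∈ x then 1 else 0

theorem wireBit_eq_one_iff {x : Finset ℕ} {w : ℕ} : wireBit x w = 1 ↔ w ∈ x := by
  simp [wireBit]

theorem wireBit_injective : Function.Injective wireBit := by
  intro x y h
  ext w
  rw [← wireBit_eq_one_iff, h, wireBit_eq_one_iff]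

theorem wireBit_symmDiff_singleton (x : Finset ℕ) (i w : ℕ) :
    wireBit (symmDiff x {i}) w = wireBit x w + if i = w then 1 else 0 := by
  have : (1 : ZMod 2) + 1 = 0 := by decide
  rcases eq_or_ne i w with rfl | h
  · by_cases hw : i ∈ x <;> simp [wireBit, Finset.mem_symmDiff, hw, this]
  · simp [wireBit, Finset.mem_symmDiff, h, h.symm]

theorem Gate.Reversible.target_notMem {g : Gate} (hg : g.Reversible) : g.target ∉ g.controls := by
  cases g <;> simp_all [Gate.target, Gate.controls, Gate.Reversible, eq_comm]

/-- A conjunction of bits is their product and a flip is an addition. For NOT the empty product of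
controls is `1`. -/
theorem Gate.Reversible.wireBit_act {g : Gate} (hg : g.Reversible) (x : Finset ℕ) (w : ℕ) :
    wireBit (g.act x) w =
      wireBit x w + if g.target = w then (g.controls.map (wireBit x)).prod else 0 := by
  cases g with
  | hadamard i => exact hg.elim
  | phaseT i => exact hg.elim
  | not i => simp [Gate.act, Gate.target, Gate.controls, wireBit_symmDiff_singleton]
  | cnot i j =>
    by_cases hi : i ∈ x
    · have : wireBit x i = 1 := wireBit_eq_one_iff.2 hi
      simp [Gate.act, Gate.target, Gate.controls, wireBit_symmDiff_singleton, hi, this]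
    · have : wireBit x i = 0 := by simp [wireBit, hi]
      simp [Gate.act, Gate.target, Gate.controls, hi, this]
  | toffoli i j k =>
    by_cases hi : i ∈ x ∧ j ∈ x
    · have h1 : wireBit x i = 1 := wireBit_eq_one_iff.2 hi.1
      have h2 : wireBit x j = 1 := wireBit_eq_one_iff.2 hi.2
      simp [Gate.act, Gate.target, Gate.controls, wireBit_symmDiff_singleton, hi, h1, h2]
    · have : wireBit x i * wireBit x j = 0 := by
        rw [not_and_or] at hi
        rcases hi with hi | hi <;> simp [wireBit, hi]
      simp [Gate.act, Gate.target, Gate.controls, hi, this]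

theorem Gate.Reversible.apply_ket {g : Gate} (hg : g.Reversible) (x : Finset ℕ) :
    g.apply (ket x) = ket (g.act x) := by
  rw [Gate.apply_ket]
  cases g with
  | hadamard i => exact hg.elim
  | phaseT i => exact hg.elim
  | not i => rfl
  | cnot i j =>
    have : i ≠ j := hg
    simp only [Gate.onKet, Gate.act, ne_eq, this, not_false_eq_true, true_and]
    split_ifs <;> rfl
  | toffoli i j k =>
    have : i ≠ k ∧ j ≠ k := hg
    simp only [Gate.onKet, Gate.act, ne_eq, this, not_false_eq_true, true_and]
    split_ifs <;> rfl

/-- The controls differ from the target, so they survive unchanged and the added product can be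
cancelled. -/
theorem Gate.Reversible.act_injective {g : Gate} (hg : g.Reversible) :
    Function.Injective g.act := by
  intro x y h
  have hw : ∀ w, wireBit (g.act x) w = wireBit (g.act y) w := fun w => by rw [h]
  simp only [hg.wireBit_act] at hw
  have h1 : ∀ w, g.target ≠ w → wireBit x w = wireBit y w := fun w hne => by
    simpa [hne] using hw w
  have h2 : g.controls.map (wireBit x) = g.controls.map (wireBit y) :=
    List.map_congr_left fun w hc => h1 w fun h => hg.target_notMem (h ▸ hc)
  refine wireBit_injective (funext fun w => ?_)
  simpa [h2] using hw w

theorem runCircuit_ket_of_reversible {C : List Gate} (hC : ∀ g ∈ C, g.Reversible) (x : Finset ℕ) :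
    runCircuit C (ket x) = ket (circuitAct C x) := by
  induction C generalizing x with
  | nil => rfl
  | cons g C ih =>
    rw [runCircuit_cons, (hC g (by simp)).apply_ket, ih fun g hg => hC g (by simp [hg])]
    rfl

theorem circuitAct_injective {C : List Gate} (hC : ∀ g ∈ C, g.Reversible) :
    Function.Injective (circuitAct C) := by
  induction C with
  | nil => exact fun _ _ h => h
  | cons g C ih =>
    exact (ih fun g hg => hC g (by simp [hg])).comp (hC g (by simp)).act_injective

/-- The sum of the values that the gates of `C` add to wire `w`, computed with the bits `v`. -/
def contribution (v : ℕ → ZMod 2) (w : ℕ) (C : List Gate) : ZMod 2 :=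
  (C.map fun g => if g.target = w then (g.controls.map v).prod else 0).sum

theorem contribution_nil (v : ℕ → ZMod 2) (w : ℕ) : contribution v w [] = 0 := rfl

theorem contribution_cons (v : ℕ → ZMod 2) (w : ℕ) (g : Gate) (C : List Gate) :
    contribution v w (g :: C) =
      (if g.target = w then (g.controls.map v).prod else 0) + contribution v w C := by
  simp [contribution]

theorem contribution_append (v : ℕ → ZMod 2) (w : ℕ) (C C' : List Gate) :
    contribution v w (C ++ C') = contribution v w C + contribution v w C' := by
  simp [contribution]

theorem contribution_flatMap_range (v : ℕ → ZMod 2) (w N : ℕ) (f : ℕ → List Gate) :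
    contribution v w ((List.range N).flatMap f) =
      ∑ i ∈ Finset.range N, contribution v w (f i) := by
  induction N with
  | zero => rfl
  | succ N ih =>
    rw [List.range_succ, List.flatMap_append, contribution_append, ih, Finset.sum_range_succ]
    simp

theorem contribution_eq_zero {v : ℕ → ZMod 2} {w : ℕ} {C : List Gate}
    (h : ∀ g ∈ C, g.target ≠ w) : contribution v w C = 0 := by
  refine List.sum_eq_zero fun a ha => ?_
  obtain ⟨g, hg, rfl⟩ := List.mem_map.1 ha
  rw [if_neg (h g hg)]

/-- A list of reversible gates in which no gate changes a control of an earlier gate. -/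
def WellOrdered (C : List Gate) : Prop :=
  (∀ g ∈ C, g.Reversible) ∧ C.Pairwise fun g g' => g'.target ∉ g.controls

/-- The final bits of a well-ordered circuit solve a system of equations. -/
theorem WellOrdered.wireBit_circuitAct {C : List Gate} (hC : WellOrdered C) (x : Finset ℕ)
    (w : ℕ) : wireBit (circuitAct C x) w =
      wireBit x w + contribution (wireBit (circuitAct C x)) w C := by
  obtain ⟨h1, h2⟩ := hC
  induction C generalizing x w with
  | nil => simp [circuitAct, contribution]
  | cons g C ih =>
    have hg : g.Reversible := h1 g (by simp)
    rw [List.pairwise_cons] at h2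
    have ih' := fun w => ih (g.act x) w (fun g hg => h1 g (by simp [hg])) h2.2
    have hcons : circuitAct (g :: C) x = circuitAct C (g.act x) := rfl
    rw [hcons, contribution_cons]
    -- Neither `g` nor any later gate changes a control of `g`, so the bits that `g` reads already
    -- have their final values.
    have hctl : g.controls.map (wireBit x) =
        g.controls.map (wireBit (circuitAct C (g.act x))) := by
      refine List.map_congr_left fun s hs => ?_
      rw [ih' s, contribution_eq_zero, hg.wireBit_act, if_neg]
      · simp
      · exact fun h => hg.target_notMem (h ▸ hs)
      · exact fun g' hg' h => h2.1 g' hg' (h ▸ hs)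
    conv_lhs => rw [ih' w, hg.wireBit_act, hctl]
    ring

theorem WellOrdered.nil : WellOrdered [] := by simp [WellOrdered]

theorem WellOrdered.append {C C' : List Gate} (h : WellOrdered C) (h' : WellOrdered C')
    (hc : ∀ g ∈ C, ∀ g' ∈ C', g'.target ∉ g.controls) : WellOrdered (C ++ C') := by
  refine ⟨fun g hg => ?_, List.pairwise_append.2 ⟨h.2, h'.2, hc⟩⟩
  rcases List.mem_append.1 hg with hg | hg
  exacts [h.1 g hg, h'.1 g hg]

theorem WellOrdered.flatMap_range {N : ℕ} {f : ℕ → List Gate} (h : ∀ i < N, WellOrdered (f i))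
    (hc : ∀ i j, i < j → j < N → ∀ g ∈ f i, ∀ g' ∈ f j, g'.target ∉ g.controls) :
    WellOrdered ((List.range N).flatMap f) := by
  induction N with
  | zero => exact .nil
  | succ N ih =>
    rw [List.range_succ, List.flatMap_append]
    refine (ih (fun i hi => h i (by lia)) fun i j hij hj => hc i j hij (by lia)).append
      (by simpa using h N (by lia)) fun g hg g' hg' => ?_
    obtain ⟨i, hi, hg⟩ := List.mem_flatMap.1 hg
    exact hc i N (List.mem_range.1 hi) (by lia) g hg g' (by simpa using hg')

/-! ### Ancilla wires -/

/-- An injective polynomial pairing of natural numbers. -/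
def polyPair (a b : ℕ) : ℕ := (a + b) ^ 2 + a

/-- The value lies between `(a + b)²` and `(a + b + 1)²`, the latter excluded, so it determines `a +
b` and then `a`. -/
theorem polyPair_inj {a b c d : ℕ} : polyPair a b = polyPair c d ↔ a = c ∧ b = d := by
  refine ⟨fun h => ?_, by rintro ⟨rfl, rfl⟩; rfl⟩
  unfold polyPair at h
  have : a + b = c + d := by
    rcases lt_trichotomy (a + b) (c + d) with hlt | he | hlt
    · nlinarith [Nat.pow_le_pow_left (Nat.succ_le_of_lt hlt) 2]
    · exact he
    · nlinarith [Nat.pow_le_pow_left (Nat.succ_le_of_lt hlt) 2]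
  rw [this] at h
  lia

/-- The ancilla wires, numbered from `B` on and indexed by quadruples. -/
def ancilla (B t i j b : ℕ) : ℕ := B + polyPair t (polyPair i (polyPair j b))

theorem ancilla_inj {B t i j b t' i' j' b' : ℕ} :
    ancilla B t i j b = ancilla B t' i' j' b' ↔ t = t' ∧ i = i' ∧ j = j' ∧ b = b' := by
  simp [ancilla, polyPair_inj]

theorem le_ancilla (B t i j b : ℕ) : B ≤ ancilla B t i j b := Nat.le_add_right _ _

theorem RegComputable.polyPair {d₀ : ℕ} {a b : (ℕ → ℕ) → ℕ} (ha : RegComputable d₀ a)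
    (hb : RegComputable d₀ b) : RegComputable d₀ fun r => polyPair (a r) (b r) :=
  ((ha.add hb).pow_const 2).add ha

theorem RegComputable.ancilla {d₀ : ℕ} {B t i j b : (ℕ → ℕ) → ℕ} (hB : RegComputable d₀ B)
    (ht : RegComputable d₀ t) (hi : RegComputable d₀ i) (hj : RegComputable d₀ j)
    (hb : RegComputable d₀ b) :
    RegComputable d₀ fun r => ancilla (B r) (t r) (i r) (j r) (b r) :=
  hB.add (ht.polyPair (hi.polyPair (hj.polyPair hb)))

/-! ### Blocks of data wires -/

theorem mul_add_inj {n i b i' b' : ℕ} (hb : b < n) (hb' : b' < n) :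
    i * n + b = i' * n + b' ↔ i = i' ∧ b = b' := by
  refine ⟨fun h => ?_, by rintro ⟨rfl, rfl⟩; rfl⟩
  have h1 : (i * n + b) / n = (i' * n + b') / n := by rw [h]
  have h2 : (i * n + b) % n = (i' * n + b') % n := by rw [h]
  have hn : 0 < n := by lia
  rw [mul_comm i, mul_comm i'] at h1 h2
  simp only [Nat.mul_add_div hn, Nat.div_eq_of_lt hb, Nat.div_eq_of_lt hb', Nat.mul_add_mod,
    Nat.mod_eq_of_lt hb, Nat.mod_eq_of_lt hb'] at h1 h2
  lia

/-- The wire of bit `b` of block `i`, for blocks of `n` bits. -/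
def dataWire (n i b : ℕ) : ℕ := i * n + b

theorem RegComputable.dataWire {d₀ : ℕ} {n i b : (ℕ → ℕ) → ℕ} (hn : RegComputable d₀ n)
    (hi : RegComputable d₀ i) (hb : RegComputable d₀ b) :
    RegComputable d₀ fun r => dataWire (n r) (i r) (b r) :=
  (hi.mul hn).add hb

theorem dataWire_inj {n i b i' b' : ℕ} (hb : b < n) (hb' : b' < n) :
    dataWire n i b = dataWire n i' b' ↔ i = i' ∧ b = b' := mul_add_inj hb hb'

theorem dataWire_lt {k n i b : ℕ} (hi : i < k) (hb : b < n) : dataWire n i b < k * n := by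
  unfold dataWire
  calc i * n + b < (i + 1) * n := by rw [add_mul]; lia
    _ ≤ k * n := Nat.mul_le_mul_right _ hi

theorem mem_blockWires {k n : ℕ} {x : Fin k → Fin n → Bool} {i b : ℕ} (hi : i < k) (hb : b < n) :
    dataWire n i b ∈ blockWires x ↔ x ⟨i, hi⟩ ⟨b, hb⟩ = true := by
  simp only [blockWires, Finset.mem_image, Finset.mem_filter, Finset.mem_univ, true_and,
    Prod.exists]
  constructor
  · rintro ⟨i', b', h, he⟩
    obtain ⟨h1, h2⟩ := (dataWire_inj b'.2 hb).1 he
    have h3 : i' = ⟨i, hi⟩ := Fin.ext h1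
    have h4 : b' = ⟨b, hb⟩ := Fin.ext h2
    rwa [← h3, ← h4]
  · exact fun h => ⟨_, _, h, rfl⟩

theorem lt_of_mem_blockWires {k n : ℕ} {x : Fin k → Fin n → Bool} {w : ℕ}
    (h : w ∈ blockWires x) : w < k * n := by
  simp only [blockWires, Finset.mem_image, Finset.mem_filter, Finset.mem_univ, true_and,
    Prod.exists] at h
  obtain ⟨i, b, -, rfl⟩ := h
  exact dataWire_lt i.2 b.2

theorem blockWires_injective {k n : ℕ} : Function.Injective (blockWires (k := k) (n := n)) := by
  intro x y h
  ext i b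
  have h1 := mem_blockWires (x := x) i.2 b.2
  have h2 := mem_blockWires (x := y) i.2 b.2
  rw [h, h2] at h1
  exact Bool.eq_iff_iff.2 h1.symm

/-- The acceptance probability of a reversible circuit. -/
theorem probOne_runCircuit_copies {n : ℕ} (k : ℕ) (ψ : Qubits n) {C : List Gate}
    (hC : ∀ g ∈ C, g.Reversible) (w : ℕ) :
    probOne w (runCircuit C (copies k ψ)) =
      ∑ x : Fin k → Fin n → Bool,
        if w ∈ circuitAct C (blockWires x) then ∏ i, ‖ψ (x i)‖ ^ 2 else 0 := by
  rw [copies, runCircuit_sum_smul]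
  simp only [runCircuit_ket_of_reversible hC]
  rw [probOne_sum_ket w _ (fun x => circuitAct C (blockWires x))
    ((circuitAct_injective hC).comp blockWires_injective)]
  simp [Finset.prod_pow]

/-! ### The collision circuit -/

/-- The circuit of the collision test on `m` blocks of `n` bits. Ancilla `(0, i, j, b)` receives
the bit "blocks `i` and `j` agree at `b`", ancilla `(1, i, j, b)` "they agree before `b`", ancilla
`(2, i, j, 0)` "no collision among the pairs before `(i, j)`", and `(3, 0, 0, 0)` the answer. -/
def collisionCircuit (m n : ℕ) : List Gate :=
  ((List.range m).flatMap fun i => (List.range i).flatMap fun j => (List.range n).flatMap fun b =>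
    [.not (ancilla (m * n) 0 i j b), .cnot (dataWire n i b) (ancilla (m * n) 0 i j b),
      .cnot (dataWire n j b) (ancilla (m * n) 0 i j b)]) ++
  (((List.range m).flatMap fun i => (List.range i).flatMap fun j =>
    [.not (ancilla (m * n) 1 i j 0)] ++ (List.range n).flatMap fun b =>
      [.toffoli (ancilla (m * n) 1 i j b) (ancilla (m * n) 0 i j b)
        (ancilla (m * n) 1 i j (b + 1))]) ++
  (([.not (ancilla (m * n) 2 0 0 0)] ++ (List.range m).flatMap fun i =>
    ((List.range i).flatMap fun j =>
      [.cnot (ancilla (m * n) 2 i j 0) (ancilla (m * n) 2 i (j + 1) 0),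
       .toffoli (ancilla (m * n) 2 i j 0) (ancilla (m * n) 1 i j n)
        (ancilla (m * n) 2 i (j + 1) 0)]) ++
    [.cnot (ancilla (m * n) 2 i i 0) (ancilla (m * n) 2 (i + 1) 0 0)]) ++
  [.not (ancilla (m * n) 3 0 0 0), .cnot (ancilla (m * n) 2 m 0 0) (ancilla (m * n) 3 0 0 0)]))

theorem data_ne_ancilla {k n i b B t i' j' b' : ℕ} (hB : k * n ≤ B) (hi : i < k) (hb : b < n) :
    ancilla B t i' j' b' ≠ dataWire n i b := by
  have := dataWire_lt hi hb
  have := le_ancilla B t i' j' b'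
  lia

theorem forall_mem_flatMap_range {N : ℕ} {f : ℕ → List Gate} {p : Gate → Prop} :
    (∀ g ∈ (List.range N).flatMap f, p g) ↔ ∀ i < N, ∀ g ∈ f i, p g := by
  simp only [List.forall_mem_flatMap, List.mem_range]

@[simp] theorem Gate.controls_not (i : ℕ) : (Gate.not i).controls = [] := rfl
@[simp] theorem Gate.controls_cnot (i j : ℕ) : (Gate.cnot i j).controls = [i] := rfl
@[simp] theorem Gate.controls_toffoli (i j k : ℕ) : (Gate.toffoli i j k).controls = [i, j] := rfl
@[simp] theorem Gate.target_not (i : ℕ) : (Gate.not i).target = i := rfl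
@[simp] theorem Gate.target_cnot (i j : ℕ) : (Gate.cnot i j).target = j := rfl
@[simp] theorem Gate.target_toffoli (i j k : ℕ) : (Gate.toffoli i j k).target = k := rfl

/-- Data wires are never targets, and each ancilla receives its last contribution before it first
serves as a control: the stages `0`, `1`, `2`, `3` come in this order, and inside a stage the
indices increase. -/
theorem collisionCircuit_wellOrdered (m n : ℕ) : WellOrdered (collisionCircuit m n) := by
  have hd : ∀ {i b t i' j' b' : ℕ}, i < m → b < n → ancilla (m * n) t i' j' b' ≠ dataWire n i b :=
    fun hi hb => data_ne_ancilla le_rfl hi hb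
  unfold collisionCircuit
  refine .append ?_ (.append ?_ (.append (.append ?_ ?_ ?_) ?_ ?_) ?_) ?_
  · refine .flatMap_range (fun i hi => .flatMap_range (fun j hj => .flatMap_range
      (fun b hb => ?_) ?_) ?_) ?_
    · have h1 := hd (t := 0) (i' := i) (j' := j) (b' := b) hi hb
      have h2 := hd (t := 0) (i' := i) (j' := j) (b' := b) (hj.trans hi) hb
      simp [WellOrdered, Gate.Reversible, h1, h1.symm, h2.symm]
    all_goals
      simp [forall_mem_flatMap_range, -List.mem_flatMap]
      grind
  · refine .flatMap_range (fun i hi => .flatMap_range (fun j hj => .append ?_ (.flatMap_range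
      (fun b hb => ?_) ?_) ?_) ?_) ?_
    · simp [WellOrdered, Gate.Reversible]
    · simp [WellOrdered, Gate.Reversible, ancilla_inj]
    all_goals
      simp [forall_mem_flatMap_range, ancilla_inj, -List.mem_flatMap, -List.mem_append]
      try grind
  · simp [WellOrdered, Gate.Reversible]
  · refine .flatMap_range (fun i hi => .append (.flatMap_range (fun j hj => ?_) ?_) ?_ ?_) ?_
    all_goals
      simp [WellOrdered, Gate.Reversible, forall_mem_flatMap_range, List.forall_mem_append,
        ancilla_inj, -List.mem_flatMap, -List.mem_append]
      try grind
  all_goals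
    simp [WellOrdered, Gate.Reversible, forall_mem_flatMap_range, List.forall_mem_append,
      ancilla_inj, -List.mem_flatMap, -List.mem_append]
    try grind

section

variable {m n : ℕ} {v : ℕ → ZMod 2} {i j b : ℕ}

/-- This lemma and its companions extract the equation of one wire. Since `ancilla` is injective,
only the gates that aim at this wire survive in the nested sums. -/
theorem contribution_collisionCircuit_agree (hi : i < m) (hj : j < i) (hb : b < n) :
    contribution v (ancilla (m * n) 0 i j b) (collisionCircuit m n) =
      1 + v (dataWire n i b) + v (dataWire n j b) := by
  simp [collisionCircuit, contribution_append, contribution_flatMap_range, contribution_cons,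
    contribution_nil, ancilla_inj, ite_and, Finset.sum_ite_irrel, Finset.sum_add_distrib, hi, hj,
    hb, add_assoc]

theorem contribution_collisionCircuit_chain_zero (hi : i < m) (hj : j < i) :
    contribution v (ancilla (m * n) 1 i j 0) (collisionCircuit m n) = 1 := by
  simp [collisionCircuit, contribution_append, contribution_flatMap_range, contribution_cons,
    contribution_nil, ancilla_inj, ite_and, Finset.sum_ite_irrel, hi, hj]

theorem contribution_collisionCircuit_chain_succ (hi : i < m) (hj : j < i) (hb : b < n) :
    contribution v (ancilla (m * n) 1 i j (b + 1)) (collisionCircuit m n) =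
      v (ancilla (m * n) 1 i j b) * v (ancilla (m * n) 0 i j b) := by
  simp [collisionCircuit, contribution_append, contribution_flatMap_range, contribution_cons,
    contribution_nil, ancilla_inj, ite_and, Finset.sum_ite_irrel, hi, hj,
    hb]

theorem contribution_collisionCircuit_start :
    contribution v (ancilla (m * n) 2 0 0 0) (collisionCircuit m n) = 1 := by
  simp [collisionCircuit, contribution_append, contribution_flatMap_range, contribution_cons,
    contribution_nil, ancilla_inj]

theorem contribution_collisionCircuit_row (hi : i < m) :
    contribution v (ancilla (m * n) 2 (i + 1) 0 0) (collisionCircuit m n) =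
      v (ancilla (m * n) 2 i i 0) := by
  simp [collisionCircuit, contribution_append, contribution_flatMap_range, contribution_cons,
    contribution_nil, ancilla_inj, hi]

/-- The right side is `v (1 + e)`, the conjunction of "no collision so far" with the negation of the
equality bit `e`. -/
theorem contribution_collisionCircuit_step (hi : i < m) (hj : j < i) :
    contribution v (ancilla (m * n) 2 i (j + 1) 0) (collisionCircuit m n) =
      v (ancilla (m * n) 2 i j 0) +
        v (ancilla (m * n) 2 i j 0) * v (ancilla (m * n) 1 i j n) := by
  simp [collisionCircuit, contribution_append, contribution_flatMap_range, contribution_cons,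
    contribution_nil, ancilla_inj, ite_and, Finset.sum_ite_irrel, Finset.sum_add_distrib, hi, hj]

theorem contribution_collisionCircuit_answer :
    contribution v (ancilla (m * n) 3 0 0 0) (collisionCircuit m n) =
      1 + v (ancilla (m * n) 2 m 0 0) := by
  simp [collisionCircuit, contribution_append, contribution_flatMap_range, contribution_cons,
    contribution_nil, ancilla_inj]

theorem wireBit_ancilla_eq_zero {B t b : ℕ} {x : Finset ℕ} (hx : ∀ w ∈ x, w < B) :
    wireBit x (ancilla B t i j b) = 0 :=
  if_neg fun h => (hx _ h).not_ge (le_ancilla _ _ _ _ _)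

theorem contribution_collisionCircuit_data (hi : i < m) (hb : b < n) :
    contribution v (dataWire n i b) (collisionCircuit m n) = 0 := by
  have hd : ∀ {t i' j' b' : ℕ}, ancilla (m * n) t i' j' b' ≠ dataWire n i b :=
    data_ne_ancilla le_rfl hi hb
  simp [collisionCircuit, contribution_append, contribution_flatMap_range, contribution_cons,
    contribution_nil, hd]

end

/-- The answer wire of the collision circuit carries `1` exactly if two blocks agree. -/
theorem answer_mem_collisionCircuit {m n : ℕ} (x : Fin m → Fin n → Bool) :
    ancilla (m * n) 3 0 0 0 ∈ circuitAct (collisionCircuit m n) (blockWires x) ↔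
      ¬ Function.Injective x := by
  set v := wireBit (circuitAct (collisionCircuit m n) (blockWires x)) with hv
  have h2 : (1 : ZMod 2) + 1 = 0 := by decide
  have eqn : ∀ w, v w = wireBit (blockWires x) w + contribution v w (collisionCircuit m n) :=
    (collisionCircuit_wellOrdered m n).wireBit_circuitAct (blockWires x)
  have anc : ∀ t i j b, v (ancilla (m * n) t i j b) =
      contribution v (ancilla (m * n) t i j b) (collisionCircuit m n) := fun t i j b => by
    rw [eqn, wireBit_ancilla_eq_zero fun w => lt_of_mem_blockWires, zero_add]
  have hdata : ∀ i b (hi : i < m) (hb : b < n),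
      v (dataWire n i b) = if x ⟨i, hi⟩ ⟨b, hb⟩ = true then 1 else 0 := fun i b hi hb => by
    rw [eqn, contribution_collisionCircuit_data hi hb, add_zero, wireBit]
    simp only [mem_blockWires hi hb]
  have hagree : ∀ i j b (hi : i < m) (hj : j < i) (hb : b < n),
      v (ancilla (m * n) 0 i j b) =
        if x ⟨i, hi⟩ ⟨b, hb⟩ = x ⟨j, hj.trans hi⟩ ⟨b, hb⟩ then 1 else 0 := by
    intro i j b hi hj hb
    rw [anc, contribution_collisionCircuit_agree hi hj hb, hdata i b hi hb,
      hdata j b (hj.trans hi) hb]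
    cases x ⟨i, hi⟩ ⟨b, hb⟩ <;> cases x ⟨j, hj.trans hi⟩ ⟨b, hb⟩ <;> simp [h2]
  have hchain : ∀ i j (_ : i < m) (_ : j < i), ∀ b ≤ n,
      v (ancilla (m * n) 1 i j b) = ∏ b' ∈ Finset.range b, v (ancilla (m * n) 0 i j b') := by
    intro i j hi hj b hb
    induction b with
    | zero => rw [anc, contribution_collisionCircuit_chain_zero hi hj]; simp
    | succ b ih =>
      rw [anc, contribution_collisionCircuit_chain_succ hi hj hb, ih (by lia),
        Finset.prod_range_succ]
  have heq : ∀ i j (hi : i < m) (hj : j < i), v (ancilla (m * n) 1 i j n) =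
      if x ⟨i, hi⟩ = x ⟨j, hj.trans hi⟩ then 1 else 0 := by
    intro i j hi hj
    rw [hchain i j hi hj n le_rfl]
    split_ifs with h
    · refine Finset.prod_eq_one fun b hb => ?_
      rw [hagree i j b hi hj (Finset.mem_range.1 hb), h, if_pos rfl]
    · obtain ⟨b, hb⟩ := Function.ne_iff.1 h
      refine Finset.prod_eq_zero (Finset.mem_range.2 b.2) ?_
      rw [hagree i j b hi hj b.2, if_neg hb]
  have hrow : ∀ i (_ : i < m), ∀ j ≤ i, v (ancilla (m * n) 2 i j 0) =
      v (ancilla (m * n) 2 i 0 0) *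
        ∏ j' ∈ Finset.range j, (1 + v (ancilla (m * n) 1 i j' n)) := by
    intro i hi j hj
    induction j with
    | zero => simp
    | succ j ih =>
      rw [anc, contribution_collisionCircuit_step hi hj, ih (by lia), Finset.prod_range_succ]
      ring
  have hall : ∀ i ≤ m, v (ancilla (m * n) 2 i 0 0) = ∏ i' ∈ Finset.range i,
      ∏ j' ∈ Finset.range i', (1 + v (ancilla (m * n) 1 i' j' n)) := by
    intro i hi
    induction i with
    | zero => rw [anc, contribution_collisionCircuit_start]; simp
    | succ i ih =>
      rw [anc, contribution_collisionCircuit_row hi, hrow i hi i le_rfl, ih (by lia),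
        Finset.prod_range_succ]
  -- The answer is `1` plus a product of negated equality bits. It equals `1` exactly when the
  -- product vanishes, that is, when some factor does.
  rw [← wireBit_eq_one_iff, ← hv, anc, contribution_collisionCircuit_answer, add_eq_left,
    hall m le_rfl]
  simp only [Finset.prod_eq_zero_iff, Finset.mem_range, Function.Injective]
  push Not
  constructor
  · rintro ⟨i, hi, j, hj, h⟩
    rw [heq i j hi hj] at h
    refine ⟨⟨i, hi⟩, ⟨j, hj.trans hi⟩, by_contra fun hne => ?_, by simp [hj.ne']⟩
    simp [hne] at h
  · rintro ⟨a, c, hac, hne⟩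
    rcases lt_or_gt_of_ne hne with h | h
    · exact ⟨c, c.2, a, h, by rw [heq c a c.2 h, if_pos hac.symm, h2]⟩
    · exact ⟨a, a.2, c, h, by rw [heq a c a.2 h, if_pos hac, h2]⟩

/-- Registers `0`, `1`, `2`, `3` hold `n`, `i`, `j`, `b`, and the term follows the nesting of the
circuit. The number `m` depends on register `0` alone, so updating the loop variables does not
affect it. -/
theorem collisionCircuit_writes {m : (ℕ → ℕ) → ℕ} (hm : RegComputable 1 m) :
    Writes 1 fun r => collisionCircuit (m r) (r 0) := by
  have hm2 := hm.weaken (show 1 ≤ 2 by lia)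
  have hm3 := hm.weaken (show 1 ≤ 3 by lia)
  have hm4 := hm.weaken (show 1 ≤ 4 by lia)
  have hB : ∀ {d}, 1 ≤ d → RegComputable d fun r => m r * r 0 := fun hd =>
    (hm.weaken hd).mul (.var hd)
  have anc : ∀ {d i j b}, 1 ≤ d → RegComputable d i → RegComputable d j → RegComputable d b →
      ∀ t, RegComputable d fun r => ancilla (m r * r 0) t (i r) (j r) (b r) :=
    fun hd hi hj hb t => (hB hd).ancilla (.const _ t) hi hj hb
  have dat : ∀ {d i b}, 1 ≤ d → RegComputable d i → RegComputable d b →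
      RegComputable d fun r => dataWire (r 0) (i r) (b r) := fun hd hi hb =>
    .dataWire (.var hd) hi hb
  have mdep : ∀ (r : ℕ → ℕ) (i : ℕ), m (Function.update r 1 i) = m r := fun r i =>
    hm.1 _ _ fun j hj => by simp [Nat.lt_one_iff.1 hj]
  have mdep2 : ∀ (r : ℕ → ℕ) (i j : ℕ),
      m (Function.update (Function.update r 1 i) 2 j) = m r := fun r i j =>
    hm.1 _ _ fun j hj => by simp [Nat.lt_one_iff.1 hj]
  have mdep3 : ∀ (r : ℕ → ℕ) (i j b : ℕ),
      m (Function.update (Function.update (Function.update r 1 i) 2 j) 3 b) = m r :=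
    fun r i j b => hm.1 _ _ fun j hj => by simp [Nat.lt_one_iff.1 hj]
  have v1 : ∀ {d}, 2 ≤ d → RegComputable d fun r => r 1 := fun hd => .var hd
  have v2 : ∀ {d}, 3 ≤ d → RegComputable d fun r => r 2 := fun hd => .var hd
  have v3 : ∀ {d}, 4 ≤ d → RegComputable d fun r => r 3 := fun hd => .var hd
  have z : ∀ {d}, RegComputable d fun _ => 0 := .const _ 0
  have one : ∀ {d}, RegComputable d fun _ => 1 := .const _ 1
  refine ((Writes.loop hm (.loop (v1 le_rfl) (.loop (.var (i := 0) (by lia))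
    (((Writes.not (anc (by lia) (v1 (by lia)) (v2 (by lia)) (v3 le_rfl) 0)).append
      (.cnot (dat (by lia) (v1 (by lia)) (v3 le_rfl))
        (anc (by lia) (v1 (by lia)) (v2 (by lia)) (v3 le_rfl) 0))).append
      (.cnot (dat (by lia) (v2 (by lia)) (v3 le_rfl))
        (anc (by lia) (v1 (by lia)) (v2 (by lia)) (v3 le_rfl) 0)))))).append
    ((Writes.loop hm (.loop (v1 le_rfl) (.append
      (.not (anc (by lia) (v1 (by lia)) (v2 le_rfl) z 1))
      (.loop (.var (i := 0) (by lia))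
        (.toffoli (anc (by lia) (v1 (by lia)) (v2 (by lia)) (v3 le_rfl) 1)
          (anc (by lia) (v1 (by lia)) (v2 (by lia)) (v3 le_rfl) 0)
          (anc (by lia) (v1 (by lia)) (v2 (by lia)) ((v3 le_rfl).add one) 1)))))).append
    (((Writes.not (anc le_rfl z z z 2)).append (.loop hm (.append
      (.loop (v1 le_rfl) (.append
        (.cnot (anc (by lia) (v1 (by lia)) (v2 le_rfl) z 2)
          (anc (by lia) (v1 (by lia)) ((v2 le_rfl).add one) z 2))
        (.toffoli (anc (by lia) (v1 (by lia)) (v2 le_rfl) z 2)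
          (anc (by lia) (v1 (by lia)) (v2 le_rfl) (.var (i := 0) (by lia)) 1)
          (anc (by lia) (v1 (by lia)) ((v2 le_rfl).add one) z 2))))
      (.cnot (anc (by lia) (v1 le_rfl) (v1 le_rfl) z 2)
        (anc (by lia) ((v1 le_rfl).add one) z z 2))))).append
    ((Writes.not (anc le_rfl z z z 3)).append
      (.cnot (anc le_rfl hm z z 2) (anc le_rfl z z z 3)))))).congr fun r => ?_
  simp [collisionCircuit, mdep, mdep2, mdep3]

theorem acceptProb_eq_collisionProb {A : Prog} {m n : ℕ}
    (hc : (A.run n).circ = collisionCircuit m n) (hw : (A.run n).reg 0 = ancilla (m * n) 3 0 0 0)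
    (ψ : Qubits n) : acceptProb A m ψ = collisionProb m ψ := by
  classical
  rw [acceptProb, hc, hw, probOne_runCircuit_copies m ψ (collisionCircuit_wellOrdered m n).1,
    collisionProb, Finset.sum_filter]
  simp only [answer_mem_collisionCircuit]

/-! ### Rational polynomials -/

/-- Registers hold natural numbers only, so signs and denominators must be separated before a
program can evaluate `p`. -/
theorem exists_polynomial_sub_div (p : ℚ[X]) : ∃ (a b : ℕ[X]) (D : ℕ), 0 < D ∧
    ∀ n : ℕ, p.eval (n : ℚ) = (((a.eval n : ℕ) : ℚ) - (b.eval n : ℕ)) / D := by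
  induction p using Polynomial.induction_on' with
  | add p q hp hq =>
    obtain ⟨a, b, D, hD, h⟩ := hp
    obtain ⟨a', b', D', hD', h'⟩ := hq
    refine ⟨C D' * a + C D * a', C D' * b + C D * b', D * D', Nat.mul_pos hD hD', fun n => ?_⟩
    have : (D : ℚ) ≠ 0 := by positivity
    have : (D' : ℚ) ≠ 0 := by positivity
    rw [eval_add, h, h']
    simp
    field_simp
    ring
  | monomial k c =>
    refine ⟨monomial k c.num.toNat, monomial k (-c.num).toNat, c.den, c.den_pos, fun n => ?_⟩
    have hc : ((c.num.toNat : ℚ) - ((-c.num).toNat : ℚ)) / c.den = c := by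
      conv_rhs => rw [← Rat.num_div_den c]
      congr 1
      have : ((c.num.toNat : ℤ) - ((-c.num).toNat : ℤ)) = c.num := by omega
      exact_mod_cast this
    simp only [eval_monomial, Nat.cast_mul, Nat.cast_pow]
    conv_lhs => rw [← hc]
    ring

/-- At negative values the natural floor and the truncated subtraction both give `0`, so no case
distinction is needed in the program. -/
theorem exists_floor_eval_eq (p : ℚ[X]) : ∃ (a b : ℕ[X]) (D : ℕ), 0 < D ∧
    ∀ n : ℕ, ⌊p.eval (n : ℚ)⌋₊ = (a.eval n - b.eval n) / D := by
  obtain ⟨a, b, D, hD, h⟩ := exists_polynomial_sub_div p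
  refine ⟨a, b, D, hD, fun n => ?_⟩
  rw [h]
  rcases le_total (b.eval n) (a.eval n) with hle | hle
  · rw [← Nat.cast_sub hle, Nat.floor_div_eq_div]
  · rw [Nat.sub_eq_zero_of_le hle, Nat.zero_div, Nat.floor_eq_zero]
    refine lt_of_le_of_lt (div_nonpos_of_nonpos_of_nonneg ?_ (by positivity)) one_pos
    have : ((a.eval n : ℕ) : ℚ) ≤ (b.eval n : ℕ) := by exact_mod_cast hle
    linarith

/-- Dropping the subtracted part and the denominator only increases the value. The added `1` makes
the bound positive, so that it can later serve as a divisor. -/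
theorem exists_eval_le (p : ℚ[X]) :
    ∃ P : ℕ[X], ∀ n : ℕ, 1 ≤ P.eval n ∧ p.eval (n : ℚ) ≤ (P.eval n : ℕ) := by
  obtain ⟨a, b, D, hD, h⟩ := exists_polynomial_sub_div p
  refine ⟨a + 1, fun n => ⟨by simp, ?_⟩⟩
  rw [h, div_le_iff₀ (by positivity)]
  have h1 : (1 : ℚ) ≤ D := by exact_mod_cast hD
  have h2 : (0 : ℚ) ≤ (a.eval n : ℕ) := by positivity
  have h3 : (0 : ℚ) ≤ (b.eval n : ℕ) := by positivity
  simp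
  nlinarith

theorem exists_collision_algorithm (p : ℚ[X]) : ∃ A : Prog, A.PolyTime ∧
    ∀ (n : ℕ) (ψ : Qubits n), acceptProb A (⌊p.eval (n : ℚ)⌋₊ + 1) ψ =
      collisionProb (⌊p.eval (n : ℚ)⌋₊ + 1) ψ := by
  obtain ⟨a, b, D, hD, h⟩ := exists_floor_eval_eq p
  have hv : RegComputable 1 fun r => r 0 := .var one_pos
  have hm : RegComputable 1 fun r => (a.eval (r 0) - b.eval (r 0)) / D + 1 :=
    (((hv.polynomial_eval a).sub (hv.polynomial_eval b)).div_const hD).add (.const _ 1)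
  obtain ⟨A, hA, hrun⟩ := (collisionCircuit_writes hm).exists_polyTime
    ((hm.mul hv).ancilla (.const _ 3) (.const _ 0) (.const _ 0) (.const _ 0))
  refine ⟨A, hA, fun n ψ => ?_⟩
  rw [h]
  exact acceptProb_eq_collisionProb (hrun n).1 (hrun n).2 ψ

/-! ### The threshold circuit -/

/-- The wires that carry a `1` when `k` blocks of `n` bits and then `k` single bits, the coins,
are written on the wires `0, …, k * n + k - 1`. -/
def trialWires {k n : ℕ} (ω : Fin k → (Fin n → Bool) × Bool) : Finset ℕ :=
  blockWires (fun i => (ω i).1) ∪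
    (Finset.univ.filter fun i => (ω i).2 = true).image fun i : Fin k => k * n + (i : ℕ)

theorem dataWire_mem_trialWires {k n : ℕ} {ω : Fin k → (Fin n → Bool) × Bool} {i b : ℕ}
    (hi : i < k) (hb : b < n) : dataWire n i b ∈ trialWires ω ↔ (ω ⟨i, hi⟩).1 ⟨b, hb⟩ = true := by
  rw [trialWires, Finset.mem_union, mem_blockWires hi hb, or_iff_left]
  have := dataWire_lt hi hb
  simp only [Finset.mem_image, Finset.mem_filter, not_exists, not_and]
  intro i' _
  lia

theorem coin_mem_trialWires {k n : ℕ} {ω : Fin k → (Fin n → Bool) × Bool} {i : ℕ}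
    (hi : i < k) : k * n + i ∈ trialWires ω ↔ (ω ⟨i, hi⟩).2 = true := by
  rw [trialWires, Finset.mem_union, or_iff_right]
  · simp only [Finset.mem_image, Finset.mem_filter, Finset.mem_univ, true_and, add_right_inj]
    constructor
    · rintro ⟨i', h, rfl⟩
      exact h
    · exact fun h => ⟨⟨i, hi⟩, h, rfl⟩
  · intro h
    have := lt_of_mem_blockWires h
    lia

theorem lt_of_mem_trialWires {k n : ℕ} {ω : Fin k → (Fin n → Bool) × Bool} {w : ℕ}
    (h : w ∈ trialWires ω) : w < k * n + k := by
  rcases Finset.mem_union.1 h with h | h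
  · have := lt_of_mem_blockWires h
    lia
  · obtain ⟨i, -, rfl⟩ := Finset.mem_image.1 h
    lia

/-- The trial with measured block `y` and coin `z` succeeds if `y = 0` or `z = 1`. -/
def TrialSuccess {n : ℕ} (a : (Fin n → Bool) × Bool) : Prop :=
  a.2 = true ∨ a.1 = fun _ => false

/-- The circuit that decides if at least `t` of `k` trials succeed. Ancilla `(0, i, b, 0)` receives
the bit "block `i` vanishes before `b`", `(1, i, b, 0)` the negated bit `b` of block `i`,
`(2, i, 0, 0)` "trial `i` succeeds", `(3, i, j, 0)` "exactly `j` of the first `i` trials succeed",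
and `(4, 0, 0, 0)` the answer. -/
def thresholdCircuit (k t n : ℕ) : List Gate :=
  ((List.range k).flatMap fun i =>
    [.not (ancilla (k * n + k) 0 i 0 0)] ++
    (((List.range n).flatMap fun b =>
      [.not (ancilla (k * n + k) 1 i b 0),
       .cnot (dataWire n i b) (ancilla (k * n + k) 1 i b 0),
       .toffoli (ancilla (k * n + k) 0 i b 0) (ancilla (k * n + k) 1 i b 0)
        (ancilla (k * n + k) 0 i (b + 1) 0)]) ++
    [.cnot (ancilla (k * n + k) 0 i n 0) (ancilla (k * n + k) 2 i 0 0),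
     .cnot (k * n + i) (ancilla (k * n + k) 2 i 0 0),
     .toffoli (ancilla (k * n + k) 0 i n 0) (k * n + i) (ancilla (k * n + k) 2 i 0 0)])) ++
  (([.not (ancilla (k * n + k) 3 0 0 0)] ++
    (List.range k).flatMap fun i => (List.range (k + 1)).flatMap fun j =>
      [.cnot (ancilla (k * n + k) 3 i j 0) (ancilla (k * n + k) 3 (i + 1) j 0),
       .toffoli (ancilla (k * n + k) 3 i j 0) (ancilla (k * n + k) 2 i 0 0)
        (ancilla (k * n + k) 3 (i + 1) j 0),
       .toffoli (ancilla (k * n + k) 3 i j 0) (ancilla (k * n + k) 2 i 0 0)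
        (ancilla (k * n + k) 3 (i + 1) (j + 1) 0)]) ++
  (List.range (k + 1 - t)).flatMap fun j =>
    [.cnot (ancilla (k * n + k) 3 k (t + j) 0) (ancilla (k * n + k) 4 0 0 0)])

theorem ancilla_ne_coin {k n i t i' j' b' : ℕ} (hi : i < k) :
    ancilla (k * n + k) t i' j' b' ≠ k * n + i := by
  have := le_ancilla (k * n + k) t i' j' b'
  lia

/-- Data and coin wires are only read. The counters of row `i + 1` are built from those of row `i`
and from the success bits, all finished earlier. -/
theorem thresholdCircuit_wellOrdered (k t n : ℕ) : WellOrdered (thresholdCircuit k t n) := by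
  have hd : ∀ {i b t i' j' b' : ℕ}, i < k → b < n →
      ancilla (k * n + k) t i' j' b' ≠ dataWire n i b :=
    fun hi hb => data_ne_ancilla (by lia) hi hb
  have hc : ∀ {i t i' j' b' : ℕ}, i < k → ancilla (k * n + k) t i' j' b' ≠ k * n + i :=
    fun hi => ancilla_ne_coin hi
  -- Only the disjointness of coins and ancillas matters below, so the formula for the coin wires is
  -- hidden.
  generalize hcoin : (fun i => k * n + i) = coin at hc
  have hcoin' : ∀ i, k * n + i = coin i := fun i => by rw [← hcoin]
  unfold thresholdCircuit
  simp only [hcoin'] at hc hd ⊢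
  refine .append ?_ (.append (.append ?_ ?_ ?_) ?_ ?_) ?_
  · refine .flatMap_range (fun i hi => .append ?_ (.append (.flatMap_range
      (fun b hb => ?_) ?_) ?_ ?_) ?_) ?_
    · simp [WellOrdered, Gate.Reversible]
    · simp [WellOrdered, Gate.Reversible, ancilla_inj, hd hi hb, (hd hi hb).symm]
    · simp [ancilla_inj, -List.mem_flatMap]
      grind
    · simp [WellOrdered, Gate.Reversible, ancilla_inj, hc hi, (hc hi).symm]
    all_goals
      simp [forall_mem_flatMap_range, List.forall_mem_append, ancilla_inj, -List.mem_flatMap,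
        -List.mem_append]
      try grind
    intro i j hij hj
    simp +contextual [hd (hij.trans hj), hc (hij.trans hj), hij.ne']
  · simp [WellOrdered, Gate.Reversible]
  · refine .flatMap_range (fun i hi => .flatMap_range (fun j hj => ?_) ?_) ?_
    all_goals
      simp [WellOrdered, Gate.Reversible, forall_mem_flatMap_range, ancilla_inj,
        -List.mem_flatMap, -List.mem_append]
      try grind
  · simp [forall_mem_flatMap_range, -List.mem_flatMap]
  · refine .flatMap_range (fun j hj => ?_) ?_
    all_goals
      simp [WellOrdered, Gate.Reversible, ancilla_inj]
  all_goals
    simp [forall_mem_flatMap_range, List.forall_mem_append,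
      ancilla_inj, -List.mem_flatMap, -List.mem_append]
    try grind

section

variable {k t n : ℕ} {v : ℕ → ZMod 2} {i j b : ℕ}

theorem contribution_thresholdCircuit_data (hi : i < k) (hb : b < n) :
    contribution v (dataWire n i b) (thresholdCircuit k t n) = 0 := by
  have hd : ∀ {t i' j' b' : ℕ}, ancilla (k * n + k) t i' j' b' ≠ dataWire n i b :=
    data_ne_ancilla (by lia) hi hb
  simp [thresholdCircuit, contribution_append, contribution_flatMap_range, contribution_cons,
    contribution_nil, hd]

theorem contribution_thresholdCircuit_coin (hi : i < k) :
    contribution v (k * n + i) (thresholdCircuit k t n) = 0 := by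
  have hd : ∀ {t i' j' b' : ℕ}, ancilla (k * n + k) t i' j' b' ≠ k * n + i := ancilla_ne_coin hi
  simp [thresholdCircuit, contribution_append, contribution_flatMap_range, contribution_cons,
    contribution_nil, hd]

theorem contribution_thresholdCircuit_chain_zero (hi : i < k) :
    contribution v (ancilla (k * n + k) 0 i 0 0) (thresholdCircuit k t n) = 1 := by
  simp [thresholdCircuit, contribution_append, contribution_flatMap_range, contribution_cons,
    contribution_nil, ancilla_inj, hi]

theorem contribution_thresholdCircuit_chain_succ (hi : i < k) (hb : b < n) :
    contribution v (ancilla (k * n + k) 0 i (b + 1) 0) (thresholdCircuit k t n) =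
      v (ancilla (k * n + k) 0 i b 0) * v (ancilla (k * n + k) 1 i b 0) := by
  simp [thresholdCircuit, contribution_append, contribution_flatMap_range, contribution_cons,
    contribution_nil, ancilla_inj, ite_and, Finset.sum_ite_irrel, hi, hb]

theorem contribution_thresholdCircuit_negated (hi : i < k) (hb : b < n) :
    contribution v (ancilla (k * n + k) 1 i b 0) (thresholdCircuit k t n) =
      1 + v (dataWire n i b) := by
  simp [thresholdCircuit, contribution_append, contribution_flatMap_range, contribution_cons,
    contribution_nil, ancilla_inj, ite_and, Finset.sum_ite_irrel, Finset.sum_add_distrib, hi, hb]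

theorem contribution_thresholdCircuit_success (hi : i < k) :
    contribution v (ancilla (k * n + k) 2 i 0 0) (thresholdCircuit k t n) =
      v (ancilla (k * n + k) 0 i n 0) + v (k * n + i) +
        v (ancilla (k * n + k) 0 i n 0) * v (k * n + i) := by
  simp [thresholdCircuit, contribution_append, contribution_flatMap_range, contribution_cons,
    contribution_nil, ancilla_inj, Finset.sum_add_distrib, hi,
    add_assoc]

theorem contribution_thresholdCircuit_count_zero :
    contribution v (ancilla (k * n + k) 3 0 j 0) (thresholdCircuit k t n) =
      if j = 0 then 1 else 0 := by
  simp [thresholdCircuit, contribution_append, contribution_flatMap_range, contribution_cons,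
    contribution_nil, ancilla_inj, eq_comm]

theorem contribution_thresholdCircuit_count_succ_zero (hi : i < k) :
    contribution v (ancilla (k * n + k) 3 (i + 1) 0 0) (thresholdCircuit k t n) =
      v (ancilla (k * n + k) 3 i 0 0) +
        v (ancilla (k * n + k) 3 i 0 0) * v (ancilla (k * n + k) 2 i 0 0) := by
  simp [thresholdCircuit, contribution_append, contribution_flatMap_range, contribution_cons,
    contribution_nil, ancilla_inj, ite_and, Finset.sum_ite_irrel, Finset.sum_add_distrib, hi]

/-- With success bit `s` this reads `c_{j+1} (1 + s) + c_j s`: the count `j + 1` persists after a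
failure or is reached from `j` by a success. -/
theorem contribution_thresholdCircuit_count_succ_succ (hi : i < k) (hj : j < k) :
    contribution v (ancilla (k * n + k) 3 (i + 1) (j + 1) 0) (thresholdCircuit k t n) =
      v (ancilla (k * n + k) 3 i (j + 1) 0) +
        v (ancilla (k * n + k) 3 i (j + 1) 0) * v (ancilla (k * n + k) 2 i 0 0) +
        v (ancilla (k * n + k) 3 i j 0) * v (ancilla (k * n + k) 2 i 0 0) := by
  have : j < k + 1 := by lia
  simp [thresholdCircuit, contribution_append, contribution_flatMap_range, contribution_cons,
    contribution_nil, ancilla_inj, ite_and, Finset.sum_ite_irrel, Finset.sum_add_distrib, hi, hj,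
    this, add_assoc]

theorem contribution_thresholdCircuit_answer :
    contribution v (ancilla (k * n + k) 4 0 0 0) (thresholdCircuit k t n) =
      ∑ j ∈ Finset.range (k + 1 - t), v (ancilla (k * n + k) 3 k (t + j) 0) := by
  simp [thresholdCircuit, contribution_append, contribution_flatMap_range, contribution_cons,
    contribution_nil, ancilla_inj]

end

open Classical in
/-- The answer wire of the threshold circuit carries `1` exactly if at least `t` trials succeed. -/
theorem answer_mem_thresholdCircuit {k n : ℕ} (t : ℕ) (ω : Fin k → (Fin n → Bool) × Bool) :
    ancilla (k * n + k) 4 0 0 0 ∈ circuitAct (thresholdCircuit k t n) (trialWires ω) ↔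
      t ≤ (Finset.univ.filter fun i => TrialSuccess (ω i)).card := by
  set v := wireBit (circuitAct (thresholdCircuit k t n) (trialWires ω)) with hv
  have h2 : (1 : ZMod 2) + 1 = 0 := by decide
  have eqn : ∀ w, v w = wireBit (trialWires ω) w + contribution v w (thresholdCircuit k t n) :=
    (thresholdCircuit_wellOrdered k t n).wireBit_circuitAct (trialWires ω)
  have anc : ∀ t' i j b, v (ancilla (k * n + k) t' i j b) =
      contribution v (ancilla (k * n + k) t' i j b) (thresholdCircuit k t n) := fun t i j b => by
    rw [eqn, wireBit_ancilla_eq_zero fun w => lt_of_mem_trialWires, zero_add]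
  have hneg : ∀ i b (hi : i < k) (hb : b < n), v (ancilla (k * n + k) 1 i b 0) =
      if (ω ⟨i, hi⟩).1 ⟨b, hb⟩ = false then 1 else 0 := fun i b hi hb => by
    rw [anc, contribution_thresholdCircuit_negated hi hb, eqn,
      contribution_thresholdCircuit_data hi hb, add_zero, wireBit]
    simp only [dataWire_mem_trialWires hi hb]
    cases (ω ⟨i, hi⟩).1 ⟨b, hb⟩ <;> simp [h2]
  have hchain : ∀ i (_ : i < k), ∀ b ≤ n, v (ancilla (k * n + k) 0 i b 0) =
      ∏ b' ∈ Finset.range b, v (ancilla (k * n + k) 1 i b' 0) := by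
    intro i hi b hb
    induction b with
    | zero => rw [anc, contribution_thresholdCircuit_chain_zero hi]; simp
    | succ b ih =>
      rw [anc, contribution_thresholdCircuit_chain_succ hi hb, ih (by lia),
        Finset.prod_range_succ]
  have hzero : ∀ i (hi : i < k), v (ancilla (k * n + k) 0 i n 0) =
      if (ω ⟨i, hi⟩).1 = fun _ => false then 1 else 0 := by
    intro i hi
    rw [hchain i hi n le_rfl]
    split_ifs with h
    · refine Finset.prod_eq_one fun b hb => ?_
      rw [hneg i b hi (Finset.mem_range.1 hb), h, if_pos rfl]
    · obtain ⟨b, hb⟩ := Function.ne_iff.1 h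
      refine Finset.prod_eq_zero (Finset.mem_range.2 b.2) ?_
      rw [hneg i b hi b.2, if_neg hb]
  -- Over `ZMod 2` the polynomial `a + b + a b` is the disjunction of `a` and `b`.
  have hsucc : ∀ i (hi : i < k), v (ancilla (k * n + k) 2 i 0 0) =
      if TrialSuccess (ω ⟨i, hi⟩) then 1 else 0 := by
    intro i hi
    rw [anc, contribution_thresholdCircuit_success hi, hzero i hi, eqn,
      contribution_thresholdCircuit_coin hi, add_zero, wireBit, TrialSuccess]
    simp only [coin_mem_trialWires hi]
    by_cases h1 : (ω ⟨i, hi⟩).1 = fun _ => false <;>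
      by_cases h3 : (ω ⟨i, hi⟩).2 = true <;> simp [h1, h3, h2]
  -- Success is extended by "false" beyond `k`, so that the counts are sums over initial ranges of
  -- natural numbers.
  set s : ℕ → Prop := fun i => ∃ hi : i < k, TrialSuccess (ω ⟨i, hi⟩) with hs
  have hcount : ∀ i ≤ k, ∀ j ≤ k, v (ancilla (k * n + k) 3 i j 0) =
      if ∑ i' ∈ Finset.range i, (if s i' then 1 else 0) = j then 1 else 0 := by
    intro i hi
    induction i with
    | zero =>
      intro j hj
      rw [anc, contribution_thresholdCircuit_count_zero]
      simp [eq_comm]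
    | succ i ih =>
      intro j hj
      have hS : v (ancilla (k * n + k) 2 i 0 0) = if s i then 1 else 0 := by
        rw [hsucc i hi]
        simp [hs, (show i < k from hi)]
      rw [anc, Finset.sum_range_succ]
      cases j with
      | zero =>
        rw [contribution_thresholdCircuit_count_succ_zero hi, ih (by lia) 0 (by lia), hS]
        generalize (∑ i' ∈ Finset.range i, if s i' then 1 else 0) = c
        by_cases h : s i <;> by_cases hc : c = 0 <;> simp [h, hc, h2]
      | succ j =>
        rw [contribution_thresholdCircuit_count_succ_succ hi hj, ih (by lia) _ hj,
          ih (by lia) _ (by lia), hS]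
        generalize (∑ i' ∈ Finset.range i, if s i' then 1 else 0) = c
        by_cases h : s i <;> by_cases hc : c = j <;> by_cases hc' : c = j + 1 <;>
          simp [h, hc, hc', h2]
  have hcard : (Finset.univ.filter fun i => TrialSuccess (ω i)).card =
      ∑ i' ∈ Finset.range k, (if s i' then 1 else 0) := by
    rw [Finset.card_filter, Finset.sum_range]
    exact Finset.sum_congr rfl fun i _ => by simp [hs]
  have hle : (Finset.univ.filter fun i => TrialSuccess (ω i)).card ≤ k := by
    simpa using Finset.card_le_univ (Finset.univ.filter fun i => TrialSuccess (ω i))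
  rw [← wireBit_eq_one_iff, ← hv, anc, contribution_thresholdCircuit_answer]
  -- Exactly one counter in the last row is set, so at most one term is nonzero and the sum modulo
  -- `2` acts as a disjunction.
  have hsum : ∑ j ∈ Finset.range (k + 1 - t), v (ancilla (k * n + k) 3 k (t + j) 0) =
      ∑ j ∈ Finset.range (k + 1 - t),
        if (Finset.univ.filter fun i => TrialSuccess (ω i)).card = t + j then 1 else 0 := by
    refine Finset.sum_congr rfl fun j hj => ?_
    rw [hcount k le_rfl _ (by have := Finset.mem_range.1 hj; lia), hcard]
  rw [hsum]
  generalize (Finset.univ.filter fun i => TrialSuccess (ω i)).card = c at hle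
  by_cases h : t ≤ c
  · simp only [h, iff_true]
    rw [Finset.sum_eq_single_of_mem (c - t) (Finset.mem_range.2 (by lia))]
    · rw [if_pos (by lia)]
    · exact fun j _ hj => if_neg (by lia)
  · simp only [h, iff_false]
    rw [Finset.sum_eq_zero fun j _ => if_neg (by lia)]
    decide

theorem thresholdCircuit_writes {k t : (ℕ → ℕ) → ℕ} (hk : RegComputable 1 k)
    (ht : RegComputable 1 t) : Writes 1 fun r => thresholdCircuit (k r) (t r) (r 0) := by
  have hB : ∀ {d}, 1 ≤ d → RegComputable d fun r => k r * r 0 + k r := fun hd =>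
    ((hk.weaken hd).mul (.var hd)).add (hk.weaken hd)
  have anc : ∀ {d i j b}, 1 ≤ d → RegComputable d i → RegComputable d j → RegComputable d b →
      ∀ t, RegComputable d fun r => ancilla (k r * r 0 + k r) t (i r) (j r) (b r) :=
    fun hd hi hj hb t => (hB hd).ancilla (.const _ t) hi hj hb
  have coin : ∀ {d i}, 1 ≤ d → RegComputable d i → RegComputable d fun r => k r * r 0 + i r :=
    fun hd hi => ((hk.weaken hd).mul (.var hd)).add hi
  have dep : ∀ {f : (ℕ → ℕ) → ℕ}, RegComputable 1 f → ∀ (r : ℕ → ℕ) (i : ℕ),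
      f (Function.update r 1 i) = f r := fun hf r i =>
    hf.1 _ _ fun j hj => by simp [Nat.lt_one_iff.1 hj]
  have dep2 : ∀ {f : (ℕ → ℕ) → ℕ}, RegComputable 1 f → ∀ (r : ℕ → ℕ) (i j : ℕ),
      f (Function.update (Function.update r 1 i) 2 j) = f r := fun hf r i j =>
    hf.1 _ _ fun j hj => by simp [Nat.lt_one_iff.1 hj]
  have v0 : ∀ {d}, 1 ≤ d → RegComputable d fun r => r 0 := fun hd => .var hd
  have v1 : ∀ {d}, 2 ≤ d → RegComputable d fun r => r 1 := fun hd => .var hd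
  have v2 : ∀ {d}, 3 ≤ d → RegComputable d fun r => r 2 := fun hd => .var hd
  have z : ∀ {d}, RegComputable d fun _ => 0 := .const _ 0
  have one : ∀ {d}, RegComputable d fun _ => 1 := .const _ 1
  refine ((Writes.loop hk (.append (.not (anc (by lia) (v1 le_rfl) z z 0)) (.append
    (.loop (v0 (by lia)) (.append (.not (anc (by lia) (v1 (by lia)) (v2 le_rfl) z 1)) (.append
      (.cnot (.dataWire (v0 (by lia)) (v1 (by lia)) (v2 le_rfl))
        (anc (by lia) (v1 (by lia)) (v2 le_rfl) z 1))
      (.toffoli (anc (by lia) (v1 (by lia)) (v2 le_rfl) z 0)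
        (anc (by lia) (v1 (by lia)) (v2 le_rfl) z 1)
        (anc (by lia) (v1 (by lia)) ((v2 le_rfl).add one) z 0)))))
    (.append (.cnot (anc (by lia) (v1 le_rfl) (v0 (by lia)) z 0)
      (anc (by lia) (v1 le_rfl) z z 2)) (.append
    (.cnot (coin (by lia) (v1 le_rfl)) (anc (by lia) (v1 le_rfl) z z 2))
    (.toffoli (anc (by lia) (v1 le_rfl) (v0 (by lia)) z 0) (coin (by lia) (v1 le_rfl))
      (anc (by lia) (v1 le_rfl) z z 2))))))).append
    (((Writes.not (anc le_rfl z z z 3)).append (.loop hk (.loop ((hk.weaken (by lia)).add one)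
      (.append (.cnot (anc (by lia) (v1 (by lia)) (v2 le_rfl) z 3)
        (anc (by lia) ((v1 (by lia)).add one) (v2 le_rfl) z 3)) (.append
      (.toffoli (anc (by lia) (v1 (by lia)) (v2 le_rfl) z 3) (anc (by lia) (v1 (by lia)) z z 2)
        (anc (by lia) ((v1 (by lia)).add one) (v2 le_rfl) z 3))
      (.toffoli (anc (by lia) (v1 (by lia)) (v2 le_rfl) z 3) (anc (by lia) (v1 (by lia)) z z 2)
        (anc (by lia) ((v1 (by lia)).add one) ((v2 le_rfl).add one) z 3))))))).append
    (.loop ((hk.add one).sub ht)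
      (.cnot (anc (by lia) (hk.weaken (by lia)) ((ht.weaken (by lia)).add (v1 le_rfl)) z 3)
        (anc (by lia) z z z 4))))).congr fun r => ?_
  simp [thresholdCircuit, dep hk, dep2 hk, dep ht]

/-! ### A layer of Hadamard gates -/

/-- Hadamard gates on the wires `0, …, L - 1`. -/
def hadamardLayer (L : ℕ) : List Gate := (List.range L).flatMap fun i => [.hadamard i]

theorem hadamardLayer_succ (L : ℕ) : hadamardLayer (L + 1) = hadamardLayer L ++ [.hadamard L] := by
  simp [hadamardLayer, List.range_succ]

theorem hadamardLayer_writes {L : (ℕ → ℕ) → ℕ} (hL : RegComputable 1 L) :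
    Writes 1 fun r => hadamardLayer (L r) :=
  (Writes.loop hL (.hadamard (.var (i := 1) one_lt_two))).congr fun r => by simp [hadamardLayer]

/-- By induction on `L`: the Hadamard gate on wire `L` splits each term `y` into `y` and `insert L
y`, with a sign in the latter exactly if `L ∈ x`. The wires from `L` on keep their bits. -/
theorem runCircuit_hadamardLayer_ket (L : ℕ) (x : Finset ℕ) :
    runCircuit (hadamardLayer L) (ket x) =
      ∑ y ∈ (Finset.range L).powerset, (((1 / Real.sqrt 2 : ℝ) : ℂ) ^ L * (-1) ^ (x ∩ y).card) •
        ket (x.filter (L ≤ ·) ∪ y) := by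
  induction L with
  | zero => simp [hadamardLayer, runCircuit]
  | succ L ih =>
    rw [hadamardLayer_succ, runCircuit_append, ih, runCircuit_sum_smul, Finset.range_add_one,
      Finset.sum_powerset_insert Finset.notMem_range_self, ← Finset.sum_add_distrib]
    refine Finset.sum_congr rfl fun y hy => ?_
    have hLy : L ∉ y := fun h => Finset.notMem_range_self (Finset.mem_powerset.1 hy h)
    have h1 : (x.filter (L ≤ ·) ∪ y).erase L = x.filter (L + 1 ≤ ·) ∪ y := by
      ext w
      simp only [Finset.mem_erase, Finset.mem_union, Finset.mem_filter]
      constructor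
      · rintro ⟨hw, h | h⟩
        · exact .inl ⟨h.1, by lia⟩
        · exact .inr h
      · rintro (h | h)
        · exact ⟨by lia, .inl ⟨h.1, by lia⟩⟩
        · exact ⟨fun hw => hLy (hw ▸ h), .inr h⟩
    have h2 : insert L (x.filter (L ≤ ·) ∪ y) = x.filter (L + 1 ≤ ·) ∪ insert L y := by
      rw [Finset.union_insert, ← h1]
      ext w
      by_cases hw : w = L <;> simp [hw]
    have h3 : L ∈ x.filter (L ≤ ·) ∪ y ↔ L ∈ x := by
      simp [hLy]
    have h4 : ((-1 : ℂ)) ^ (x ∩ insert L y).card =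
        (if L ∈ x then -1 else 1) * (-1) ^ (x ∩ y).card := by
      split_ifs with h
      · rw [Finset.inter_insert_of_mem h, Finset.card_insert_of_notMem (by simp [hLy]), pow_succ']
      · rw [Finset.inter_insert_of_notMem h, one_mul]
    simp only [runCircuit_cons, runCircuit_nil, Gate.apply_ket, Gate.onKet, h1, h2, h3, h4,
      smul_add, smul_smul]
    congr 2 <;> ring

/-! ### Walsh-Hadamard transform -/

/-- The sign `(-1)^(x · y)`. -/
def walshSign {n : ℕ} (x y : Fin n → Bool) : ℂ := ∏ b, if x b = true ∧ y b = true then -1 else 1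

theorem walshSign_eq_neg_one_pow {n : ℕ} (x y : Fin n → Bool) :
    walshSign x y = (-1) ^ (Finset.univ.filter fun b => x b = true ∧ y b = true).card := by
  rw [walshSign, Finset.prod_ite]
  simp

/-- The coins start in state `0`, so only data wires lie in the intersection and the coins produce
no sign. -/
theorem prod_walshSign {k n : ℕ} (x : Fin k → Fin n → Bool) (ω : Fin k → (Fin n → Bool) × Bool) :
    ∏ i, walshSign (x i) (ω i).1 = (-1) ^ (blockWires x ∩ trialWires ω).card := by
  have h : blockWires x ∩ trialWires ω =
      blockWires fun i b => x i b && (ω i).1 b := by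
    ext w
    by_cases hw : ∃ (i : Fin k) (b : Fin n), w = dataWire n i b
    · obtain ⟨i, b, rfl⟩ := hw
      rw [Finset.mem_inter, mem_blockWires i.2 b.2, mem_blockWires i.2 b.2,
        dataWire_mem_trialWires i.2 b.2]
      simp
    · have hno : ∀ z : Fin k → Fin n → Bool, w ∉ blockWires z := by
        intro z hz
        simp only [blockWires, Finset.mem_image, Finset.mem_filter, Finset.mem_univ, true_and,
          Prod.exists] at hz
        obtain ⟨i, b, -, hib⟩ := hz
        exact hw ⟨i, b, hib.symm⟩
      simp [hno]
  have hinj : Function.Injective fun q : Fin k × Fin n => (q.1 : ℕ) * n + (q.2 : ℕ) := by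
    rintro ⟨i, b⟩ ⟨i', b'⟩ hq
    obtain ⟨h1, h2⟩ := (mul_add_inj b.2 b'.2).1 hq
    exact Prod.ext (Fin.ext h1) (Fin.ext h2)
  rw [h, blockWires, Finset.card_image_of_injective _ hinj, ← Finset.prod_const,
    Finset.prod_filter, Fintype.prod_prod_type]
  simp [walshSign]

/-- The probability of the outcome `y` when the Walsh-Hadamard transform of `ψ` is measured. -/
noncomputable def walshProb {n : ℕ} (ψ : Qubits n) (y : Fin n → Bool) : ℝ :=
  ‖∑ x, ψ x * walshSign x y‖ ^ 2 / 2 ^ n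

/-- Orthogonality of characters: the sum factors over the bits, and a bit where `x` and `x'` differ
gives the factor `1 - 1`. -/
theorem sum_walshSign_mul_walshSign {n : ℕ} (x x' : Fin n → Bool) :
    ∑ y, walshSign x y * walshSign x' y = if x = x' then 2 ^ n else 0 := by
  have h : ∀ y : Fin n → Bool, walshSign x y * walshSign x' y =
      ∏ b, (if x b = true ∧ y b = true then (-1 : ℂ) else 1) *
        if x' b = true ∧ y b = true then -1 else 1 := fun y => by
    rw [walshSign, walshSign, Finset.prod_mul_distrib]
  simp only [h]
  have h2 := Finset.prod_univ_sum (fun _ : Fin n => (Finset.univ : Finset Bool))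
    (fun b c => (if x b = true ∧ c = true then (-1 : ℂ) else 1) *
        if x' b = true ∧ c = true then -1 else 1)
  rw [Fintype.piFinset_univ] at h2
  rw [← h2]
  split_ifs with hx
  · subst hx
    rw [Finset.prod_congr rfl (g := fun _ => (2 : ℂ)), Finset.prod_const, Finset.card_univ,
      Fintype.card_fin]
    intro b _
    cases x b <;> norm_num
  · obtain ⟨b, hb⟩ := Function.ne_iff.1 hx
    refine Finset.prod_eq_zero (Finset.mem_univ b) ?_
    revert hb
    cases x b <;> cases x' b <;> simp

theorem walshSign_conj {n : ℕ} (x y : Fin n → Bool) :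
    (starRingEnd ℂ) (walshSign x y) = walshSign x y := by
  rw [walshSign_eq_neg_one_pow]
  simp

/-- Parseval's identity: after the squares are expanded, orthogonality leaves only the diagonal
terms. -/
theorem sum_walshProb {n : ℕ} (ψ : Qubits n) : ∑ y, walshProb ψ y = ∑ x, ‖ψ x‖ ^ 2 := by
  have h2 : (2 : ℝ) ^ n ≠ 0 := by positivity
  simp only [walshProb]
  rw [← Finset.sum_div, div_eq_iff h2]
  apply Complex.ofReal_injective
  push_cast
  have h : ∀ y, ((‖∑ x, ψ x * walshSign x y‖ : ℝ) : ℂ) ^ 2 =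
      ∑ x, ∑ x', ψ x * (starRingEnd ℂ) (ψ x') * (walshSign x y * walshSign x' y) := by
    intro y
    rw [← Complex.mul_conj', map_sum, Finset.sum_mul_sum]
    refine Finset.sum_congr rfl fun x _ => Finset.sum_congr rfl fun x' _ => ?_
    rw [map_mul, walshSign_conj]
    ring
  simp only [h]
  rw [Finset.sum_comm, Finset.sum_mul]
  refine Finset.sum_congr rfl fun x _ => ?_
  rw [Finset.sum_comm]
  simp only [← Finset.mul_sum, sum_walshSign_mul_walshSign]
  simp [Complex.mul_conj']

/-! ### The state after the Hadamard layer -/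

theorem trialWires_injective {k n : ℕ} : Function.Injective (trialWires (k := k) (n := n)) := by
  intro ω ω' h
  funext i
  refine Prod.ext (funext fun b => ?_) ?_
  · rw [Bool.eq_iff_iff, ← dataWire_mem_trialWires i.2 b.2, h, dataWire_mem_trialWires i.2 b.2]
  · rw [Bool.eq_iff_iff, ← coin_mem_trialWires i.2, h, coin_mem_trialWires i.2]

theorem exists_trialWires_eq {k n : ℕ} {y : Finset ℕ} (hy : y ⊆ Finset.range (k * n + k)) :
    ∃ ω : Fin k → (Fin n → Bool) × Bool, trialWires ω = y := by
  refine ⟨fun i => (fun b => decide (dataWire n i b ∈ y), decide (k * n + (i : ℕ) ∈ y)), ?_⟩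
  ext w
  rcases lt_or_ge w (k * n) with hw | hw
  · have hn : 0 < n := Nat.pos_of_ne_zero (by rintro rfl; simp at hw)
    have hi : w / n < k := Nat.div_lt_of_lt_mul (by rwa [mul_comm])
    have hb : w % n < n := Nat.mod_lt _ hn
    have hw' : w = dataWire n (w / n) (w % n) := by
      rw [dataWire, mul_comm, Nat.div_add_mod]
    rw [hw', dataWire_mem_trialWires hi hb]
    simp [← hw']
  · by_cases hw' : w < k * n + k
    · obtain ⟨i, rfl⟩ := Nat.exists_eq_add_of_le hw
      rw [coin_mem_trialWires (by lia)]
      simp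
    · refine iff_of_false (fun h => hw' (lt_of_mem_trialWires h)) fun h => hw' ?_
      exact Finset.mem_range.1 (hy h)

/-- Every set of the first `k * n + k` wires encodes a unique family of trial outcomes. The data
part is decoded by division with remainder by `n`. -/
theorem sum_powerset_range_eq_sum_trialWires {k n : ℕ} {M : Type*} [AddCommMonoid M]
    (f : Finset ℕ → M) : ∑ y ∈ (Finset.range (k * n + k)).powerset, f y =
      ∑ ω : Fin k → (Fin n → Bool) × Bool, f (trialWires ω) := by
  symm
  refine Finset.sum_bij (fun ω _ => trialWires ω) (fun ω _ => ?_)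
    (fun ω _ ω' _ h => trialWires_injective h) (fun y hy => ?_) fun _ _ => rfl
  · exact Finset.mem_powerset.2 fun w hw => Finset.mem_range.2 (lt_of_mem_trialWires hw)
  · obtain ⟨ω, hω⟩ := exists_trialWires_eq (Finset.mem_powerset.1 hy)
    exact ⟨ω, Finset.mem_univ _, hω⟩

/-- The copies and the signs are products over the blocks, so the sum over all input strings becomes
a product of single-block Walsh transforms. -/
theorem runCircuit_hadamardLayer_copies {k n : ℕ} (ψ : Qubits n) :
    runCircuit (hadamardLayer (k * n + k)) (copies k ψ) =
      ∑ ω : Fin k → (Fin n → Bool) × Bool,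
        (((1 / Real.sqrt 2 : ℝ) : ℂ) ^ (k * n + k) *
          ∏ i, ∑ x, ψ x * walshSign x (ω i).1) • ket (trialWires ω) := by
  have hket : ∀ x : Fin k → Fin n → Bool,
      runCircuit (hadamardLayer (k * n + k)) (ket (blockWires x)) =
      ∑ ω : Fin k → (Fin n → Bool) × Bool,
        (((1 / Real.sqrt 2 : ℝ) : ℂ) ^ (k * n + k) * ∏ i, walshSign (x i) (ω i).1) •
          ket (trialWires ω) := by
    intro x
    rw [runCircuit_hadamardLayer_ket, sum_powerset_range_eq_sum_trialWires]
    refine Finset.sum_congr rfl fun ω _ => ?_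
    have : (blockWires x).filter (k * n + k ≤ ·) = ∅ :=
      Finset.filter_eq_empty_iff.2 fun w hw => by
        have := lt_of_mem_blockWires hw
        lia
    rw [prod_walshSign, this, Finset.empty_union]
  rw [copies, runCircuit_sum_smul]
  simp only [hket, Finset.smul_sum, smul_smul]
  rw [Finset.sum_comm]
  refine Finset.sum_congr rfl fun ω _ => ?_
  rw [← Finset.sum_smul, Finset.prod_univ_sum, Fintype.piFinset_univ, Finset.mul_sum]
  congr 1
  refine Finset.sum_congr rfl fun x _ => ?_
  rw [Finset.prod_mul_distrib]
  ring

theorem probOne_hadamardLayer_append {k n : ℕ} (ψ : Qubits n) {C : List Gate}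
    (hC : ∀ g ∈ C, g.Reversible) (w : ℕ) :
    probOne w (runCircuit (hadamardLayer (k * n + k) ++ C) (copies k ψ)) =
      ∑ ω : Fin k → (Fin n → Bool) × Bool,
        if w ∈ circuitAct C (trialWires ω) then ∏ i, walshProb ψ (ω i).1 / 2 else 0 := by
  rw [runCircuit_append, runCircuit_hadamardLayer_copies, runCircuit_sum_smul]
  simp only [runCircuit_ket_of_reversible hC]
  rw [probOne_sum_ket w _ (fun ω => circuitAct C (trialWires ω))
    ((circuitAct_injective hC).comp trialWires_injective)]
  refine Finset.sum_congr rfl fun ω _ => ?_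
  congr 1
  -- The squared prefactor `2^(-(kn + k))` is shared among the trials: each takes `2^(-n)`, which is
  -- part of `walshProb`, and `1 / 2` for its coin.
  have hs : (1 / Real.sqrt 2) ^ 2 = 1 / 2 := by rw [div_pow, Real.sq_sqrt zero_le_two, one_pow]
  rw [norm_mul, mul_pow, norm_pow, Complex.norm_real, Real.norm_of_nonneg (by positivity),
    ← pow_mul, mul_comm _ 2, pow_mul, hs, norm_prod, ← Finset.prod_pow]
  simp only [walshProb, div_div]
  rw [Finset.prod_div_distrib, Finset.prod_const, Finset.card_univ, Fintype.card_fin, ← pow_succ,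
    ← pow_mul, one_div, inv_pow, div_eq_mul_inv, mul_comm, add_one_mul, mul_comm n k]

/-! ### Independent trials -/

-- Outcomes are grouped by the exact set `T` of successful trials. Each `T` has mass `q^|T| (1 -
-- q)^(k - |T|)`, and binomial coefficients count the sets of a given size.
open Classical in
theorem sum_prod_filter_card_ge {Ω : Type*} [Fintype Ω] (k t : ℕ) (μ : Ω → ℝ) (G : Ω → Prop)
    (hμ : ∑ a, μ a = 1) :
    ∑ ω : Fin k → Ω, (if t ≤ (Finset.univ.filter fun i => G (ω i)).card
      then ∏ i, μ (ω i) else 0) = atLeastProb k t (∑ a, if G a then μ a else 0) := by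
  set q := ∑ a, if G a then μ a else 0 with hq
  have hq' : ∑ a, (if G a then 0 else μ a) = 1 - q := by
    rw [eq_sub_iff_add_eq, hq, ← Finset.sum_add_distrib, ← hμ]
    exact Finset.sum_congr rfl fun a _ => by split_ifs <;> simp
  have hT : ∀ T : Finset (Fin k), ∑ ω : Fin k → Ω,
      (if (Finset.univ.filter fun i => G (ω i)) = T then ∏ i, μ (ω i) else 0) =
        q ^ T.card * (1 - q) ^ (k - T.card) := by
    intro T
    -- The condition that the success set is `T` splits into one condition per trial, which makes
    -- the sum over `ω` a product.
    have hprod : ∀ ω : Fin k → Ω,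
        (if (Finset.univ.filter fun i => G (ω i)) = T then ∏ i, μ (ω i) else 0) =
          ∏ i, if i ∈ T then (if G (ω i) then μ (ω i) else 0)
            else if G (ω i) then 0 else μ (ω i) := by
      intro ω
      split_ifs with h
      · refine Finset.prod_congr rfl fun i _ => ?_
        rw [← h]
        by_cases hi : G (ω i) <;> simp [hi]
      · symm
        obtain ⟨i, hi⟩ : ∃ i, ¬ (G (ω i) ↔ i ∈ T) := by
          by_contra hne
          push Not at hne
          exact h (Finset.ext fun i => by simpa using hne i)
        refine Finset.prod_eq_zero (Finset.mem_univ i) ?_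
        by_cases h1 : G (ω i) <;> by_cases h2 : i ∈ T <;> simp_all
    have h2 := Finset.prod_univ_sum (fun _ : Fin k => (Finset.univ : Finset Ω))
      (fun i a => if i ∈ T then (if G a then μ a else 0) else if G a then 0 else μ a)
    rw [Fintype.piFinset_univ] at h2
    simp only [hprod]
    rw [← h2]
    have h3 : ∀ i : Fin k, (∑ a, if i ∈ T then (if G a then μ a else 0)
        else if G a then 0 else μ a) = if i ∈ T then q else 1 - q := by
      intro i
      split_ifs
      · rfl
      · exact hq'
    simp only [h3]
    rw [Finset.prod_ite, Finset.prod_const, Finset.prod_const]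
    congr 2
    · simp
    · rw [Finset.filter_not, Finset.card_sdiff_of_subset (Finset.filter_subset _ _)]
      simp
  have hsplit : ∀ ω : Fin k → Ω,
      (if t ≤ (Finset.univ.filter fun i => G (ω i)).card then ∏ i, μ (ω i) else 0) =
      ∑ T : Finset (Fin k), if t ≤ T.card then
        (if (Finset.univ.filter fun i => G (ω i)) = T then ∏ i, μ (ω i) else 0) else 0 := by
    intro ω
    rw [Finset.sum_eq_single (Finset.univ.filter fun i => G (ω i))]
    · simp
    · intro T _ hne
      simp [hne.symm]
    · simp
  simp only [hsplit]
  rw [Finset.sum_comm]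
  have hT' : ∀ T : Finset (Fin k), (∑ ω : Fin k → Ω, if t ≤ T.card then
      (if (Finset.univ.filter fun i => G (ω i)) = T then ∏ i, μ (ω i) else 0) else 0) =
      if t ≤ T.card then q ^ T.card * (1 - q) ^ (k - T.card) else 0 := by
    intro T
    split_ifs
    · exact hT T
    · simp
  simp only [hT']
  rw [← Finset.powerset_univ, Finset.sum_powerset_apply_card
    (fun c => if t ≤ c then q ^ c * (1 - q) ^ (k - c) else 0), atLeastProb]
  simp only [Finset.card_univ, Fintype.card_fin, nsmul_eq_mul, mul_ite, mul_zero]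
  rw [← Finset.sum_filter]
  refine Finset.sum_congr ?_ fun j _ => by ring
  ext j
  simp
  lia

/-! ### The repeated test against the uniform superposition -/

theorem PureState.sum_norm_sq {n : ℕ} (ψ : PureState n) : ∑ x, ‖(ψ : Qubits n) x‖ ^ 2 = 1 := by
  rw [← EuclideanSpace.norm_sq_eq, norm_eq_of_mem_sphere, one_pow]

theorem walshProb_zero {n : ℕ} (ψ : Qubits n) : walshProb ψ (fun _ => false) =
    ‖inner ℂ (subsetState (Finset.univ : Finset (Fin n → Bool))) ψ‖ ^ 2 := by
  have h : inner ℂ (subsetState (Finset.univ : Finset (Fin n → Bool))) ψ =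
      ((1 / Real.sqrt (2 ^ n) : ℝ) : ℂ) * ∑ x, ψ x := by
    simp [PiLp.inner_apply, subsetState, Finset.mul_sum, mul_comm]
  rw [h, norm_mul, mul_pow, Complex.norm_real, Real.norm_of_nonneg (by positivity), div_pow,
    Real.sq_sqrt (by positivity), walshProb]
  simp [walshSign]
  ring

-- A zero outcome succeeds with both coin values and any other outcome with one. Since the outcome
-- probabilities sum to `1`, the success probability is `1 / 2` plus half the probability of zero,
-- which is the squared overlap with `u`.
open Classical in
theorem acceptProb_eq_atLeastProb {A : Prog} {k t n : ℕ}
    (hc : (A.run n).circ = hadamardLayer (k * n + k) ++ thresholdCircuit k t n)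
    (hw : (A.run n).reg 0 = ancilla (k * n + k) 4 0 0 0) (ψ : PureState n) :
    acceptProb A k (ψ : Qubits n) = atLeastProb k t (swapTestProb (ψ : Qubits n)) := by
  have h1 : ∑ y, walshProb (ψ : Qubits n) y = 1 := by rw [sum_walshProb, ψ.sum_norm_sq]
  rw [acceptProb, hc, hw, probOne_hadamardLayer_append _ (thresholdCircuit_wellOrdered k t n).1]
  simp only [answer_mem_thresholdCircuit]
  rw [sum_prod_filter_card_ge k t (fun a => walshProb (ψ : Qubits n) a.1 / 2) TrialSuccess]
  · congr 1
    rw [Fintype.sum_prod_type]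
    have : ∀ y : Fin n → Bool, (∑ z : Bool, if TrialSuccess (y, z) then
        walshProb (ψ : Qubits n) y / 2 else 0) = walshProb (ψ : Qubits n) y / 2 +
          if y = fun _ => false then walshProb (ψ : Qubits n) y / 2 else 0 := by
      intro y
      simp [TrialSuccess]
    simp only [this]
    rw [Finset.sum_add_distrib, ← Finset.sum_div, h1, Finset.sum_ite_eq', if_pos (Finset.mem_univ _),
      swapTestProb, walshProb_zero]
    ring
  · rw [Fintype.sum_prod_type]
    refine Eq.trans ?_ h1
    refine Finset.sum_congr rfl fun y _ => ?_
    simp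
    ring

theorem exists_swapTest_algorithm (k t : ℕ[X]) : ∃ A : Prog, A.PolyTime ∧
    ∀ (n : ℕ) (ψ : PureState n), acceptProb A (k.eval n) (ψ : Qubits n) =
      atLeastProb (k.eval n) (t.eval n) (swapTestProb (ψ : Qubits n)) := by
  have hv : RegComputable 1 fun r => r 0 := .var one_pos
  have hk := hv.polynomial_eval k
  have hB := (hk.mul hv).add hk
  obtain ⟨A, hA, hrun⟩ := ((hadamardLayer_writes hB).append
    (thresholdCircuit_writes hk (hv.polynomial_eval t))).exists_polyTime
    (hB.ancilla (.const _ 4) (.const _ 0) (.const _ 0) (.const _ 0))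
  exact ⟨A, hA, fun n ψ => acceptProb_eq_atLeastProb (hrun n).1 (hrun n).2 ψ⟩

/-! ### Moments of the Haar measure -/

section HaarMoments

variable {n : ℕ}

theorem toSphere_ne_zero_ne_top (n : ℕ) :
    (volume : Measure (Qubits n)).toSphere Set.univ ≠ 0 ∧
      (volume : Measure (Qubits n)).toSphere Set.univ ≠ ⊤ :=
  ⟨fun h => Measure.toSphere_ne_zero (μ := (volume : Measure (Qubits n)))
    (Measure.measure_univ_eq_zero.1 h), measure_ne_top _ _⟩

instance haarState_isProbabilityMeasure : IsProbabilityMeasure (haarState n) where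
  measure_univ := by
    obtain ⟨h0, h1⟩ := toSphere_ne_zero_ne_top n
    simpa [haarState] using ENNReal.inv_mul_cancel h0 h1

/-- The action of a linear isometry on pure states. -/
noncomputable def PureState.map (f : Qubits n ≃ₗᵢ[ℝ] Qubits n) (ψ : PureState n) : PureState n :=
  ⟨f ψ, by simp⟩

theorem PureState.continuous_map (f : Qubits n ≃ₗᵢ[ℝ] Qubits n) : Continuous (PureState.map f) :=
  (f.continuous.comp continuous_subtype_val).subtype_mk _

-- The surface measure of `s` is, up to a constant, the volume of the cone over `s`. A linear
-- isometry commutes with scaling, hence maps cones to cones, and it preserves volume.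
open scoped Pointwise in
theorem map_haarState (f : Qubits n ≃ₗᵢ[ℝ] Qubits n) :
    (haarState n).map (PureState.map f) = haarState n := by
  have hm := (PureState.continuous_map f).measurable
  suffices h : ((volume : Measure (Qubits n)).toSphere).map (PureState.map f) =
      (volume : Measure (Qubits n)).toSphere by
    rw [haarState, Measure.map_smul, h]
  ext s hs
  rw [Measure.map_apply hm hs, Measure.toSphere_apply' _ (hm hs), Measure.toSphere_apply' _ hs]
  congr 1
  have himg : ((↑) '' s : Set (Qubits n)) = f '' ((↑) '' (PureState.map f ⁻¹' s)) := by
    ext φ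
    constructor
    · rintro ⟨ψ, hψ, rfl⟩
      refine ⟨f.symm ψ, ⟨⟨f.symm ψ, by simp⟩, ?_, rfl⟩, by simp⟩
      have : PureState.map f ⟨f.symm ψ, by simp⟩ = ψ := Subtype.ext (by simp [PureState.map])
      rwa [Set.mem_preimage, this]
    · rintro ⟨_, ⟨ψ, hψ, rfl⟩, rfl⟩
      exact ⟨PureState.map f ψ, hψ, rfl⟩
  have hsmul : ∀ A : Set (Qubits n), Set.Ioo (0 : ℝ) 1 • (f '' A) = f '' (Set.Ioo (0 : ℝ) 1 • A) := by
    intro A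
    ext φ
    simp only [Set.mem_smul, Set.mem_image]
    constructor
    · rintro ⟨r, hr, _, ⟨ψ, hψ, rfl⟩, rfl⟩
      exact ⟨r • ψ, ⟨r, hr, ψ, hψ, rfl⟩, by simp⟩
    · rintro ⟨_, ⟨r, hr, ψ, hψ, rfl⟩, rfl⟩
      exact ⟨r, hr, f ψ, ⟨ψ, hψ, rfl⟩, by simp⟩
  rw [himg, hsmul]
  have h := f.measurePreserving.measure_preimage_equiv (f := f.toMeasurableEquiv)
    (f '' (Set.Ioo (0 : ℝ) 1 • ((↑) '' (PureState.map f ⁻¹' s))))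
  rw [← h]
  congr 1
  exact (Set.preimage_image_eq _ f.injective).symm

theorem integrable_haarState {g : PureState n → ℝ} (hg : Continuous g) :
    Integrable g (haarState n) :=
  hg.integrable_of_hasCompactSupport (HasCompactSupport.of_compactSpace g)

theorem continuous_real_inner (u : Qubits n) :
    Continuous fun ψ : PureState n => inner ℝ u (ψ : Qubits n) :=
  continuous_const.inner continuous_subtype_val

theorem continuous_real_inner_pow (u : Qubits n) (p : ℕ) :
    Continuous fun ψ : PureState n => inner ℝ u (ψ : Qubits n) ^ p :=
  (continuous_real_inner u).pow p

/-- The reflection in the hyperplane orthogonal to `u - v` maps `u` to `v` and preserves the Haar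
measure. -/
theorem integral_inner_pow_eq {u v : Qubits n} (h : ‖u‖ = ‖v‖) (p : ℕ) :
    ∫ ψ : PureState n, (inner ℝ u (ψ : Qubits n)) ^ p ∂(haarState n) =
      ∫ ψ : PureState n, (inner ℝ v (ψ : Qubits n)) ^ p ∂(haarState n) := by
  set f : Qubits n ≃ₗᵢ[ℝ] Qubits n := (ℝ ∙ (u - v))ᗮ.reflection with hf
  have hfu : f u = v := Submodule.reflection_sub h
  conv_rhs => rw [← map_haarState f]
  rw [integral_map (PureState.continuous_map f).aemeasurable
    (continuous_real_inner_pow v p).aestronglyMeasurable]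
  refine integral_congr_ae (ae_of_all _ fun ψ => ?_)
  simp only [PureState.map]
  rw [← hfu, f.inner_map_map]

/-- The real orthonormal basis `|x⟩`, `i|x⟩` of the state space. -/
noncomputable def realBasis (a : (Fin n → Bool) × Bool) : Qubits n :=
  EuclideanSpace.single a.1 (if a.2 then Complex.I else 1)

theorem norm_realBasis (a : (Fin n → Bool) × Bool) : ‖realBasis a‖ = 1 := by
  rw [realBasis, PiLp.norm_single]
  split_ifs <;> simp

theorem inner_realBasis (a : (Fin n → Bool) × Bool) (ψ : Qubits n) :
    inner ℝ (realBasis a) ψ = if a.2 then (ψ a.1).im else (ψ a.1).re := by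
  rw [realBasis, PiLp.inner_apply, Finset.sum_eq_single a.1]
  · split_ifs <;> simp [Complex.inner]
  · intro x _ hx
    simp [hx]
  · simp

theorem sum_inner_realBasis_sq (ψ : PureState n) :
    ∑ a, (inner ℝ (realBasis a) (ψ : Qubits n)) ^ 2 = 1 := by
  rw [Fintype.sum_prod_type]
  refine Eq.trans ?_ ψ.sum_norm_sq
  refine Finset.sum_congr rfl fun x _ => ?_
  simp [inner_realBasis, ← Complex.normSq_eq_norm_sq, Complex.normSq_apply]
  ring

theorem inner_realBasis_realBasis {a b : (Fin n → Bool) × Bool} (h : a ≠ b) :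
    inner ℝ (realBasis a) (realBasis b) = 0 := by
  obtain ⟨x, c⟩ := a
  obtain ⟨y, d⟩ := b
  rw [inner_realBasis]
  simp only [realBasis, PiLp.single_apply]
  by_cases hxy : x = y
  · subst hxy
    have : c ≠ d := fun hcd => h (by rw [hcd])
    revert this
    cases c <;> cases d <;> simp
  · simp [hxy]

/-- The `2 * 2^n` real coordinates have equal second moments, and their squares sum to `1`. -/
theorem integral_inner_sq {u : Qubits n} (hu : ‖u‖ = 1) :
    ∫ ψ : PureState n, (inner ℝ u (ψ : Qubits n)) ^ 2 ∂(haarState n) = 1 / (2 * 2 ^ n) := by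
  have h : ∑ a : (Fin n → Bool) × Bool,
      ∫ ψ : PureState n, (inner ℝ (realBasis a) (ψ : Qubits n)) ^ 2 ∂(haarState n) = 1 := by
    rw [← integral_finsetSum _ fun a _ =>
      integrable_haarState (continuous_real_inner_pow (realBasis a) 2)]
    simp only [sum_inner_realBasis_sq]
    simp
  have h2 : ∀ a : (Fin n → Bool) × Bool,
      ∫ ψ : PureState n, (inner ℝ (realBasis a) (ψ : Qubits n)) ^ 2 ∂(haarState n) =
      ∫ ψ : PureState n, (inner ℝ u (ψ : Qubits n)) ^ 2 ∂(haarState n) := fun a =>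
    integral_inner_pow_eq (by rw [norm_realBasis, hu]) 2
  simp only [h2] at h
  simp at h
  field_simp
  linarith

/-- The unit vectors `(a ± b) / √2` have the same fourth moment `m` as `a` and `b`. Adding the two
expansions cancels the odd terms and leaves `2 m = m / 2 + m / 2 + 3 E[a² b²]`. -/
theorem integral_inner_sq_mul_inner_sq {a b : (Fin n → Bool) × Bool} (h : a ≠ b) :
    ∫ ψ : PureState n, (inner ℝ (realBasis a) (ψ : Qubits n)) ^ 2 *
      (inner ℝ (realBasis b) (ψ : Qubits n)) ^ 2 ∂(haarState n) =
    (∫ ψ : PureState n, (inner ℝ (realBasis a) (ψ : Qubits n)) ^ 4 ∂(haarState n)) / 3 := by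
  have hs : (1 / Real.sqrt 2) ^ 4 = 1 / 4 := by
    rw [div_pow, show Real.sqrt 2 ^ 4 = (Real.sqrt 2 ^ 2) ^ 2 by ring,
      Real.sq_sqrt zero_le_two]
    norm_num
  have hab := inner_realBasis_realBasis h
  have hnorm : ∀ ε : ℝ, ε ^ 2 = 1 → ‖(1 / Real.sqrt 2) • (realBasis a + ε • realBasis b)‖ = 1 := by
    intro ε hε
    have h1 : ‖realBasis a + ε • realBasis b‖ ^ 2 = 2 := by
      rw [norm_add_sq_real, norm_smul, mul_pow, inner_smul_right, hab, norm_realBasis,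
        norm_realBasis, Real.norm_eq_abs, sq_abs, hε]
      norm_num
    have h2 : ‖realBasis a + ε • realBasis b‖ = Real.sqrt 2 := by
      rw [← h1, Real.sqrt_sq (norm_nonneg _)]
    rw [norm_smul, h2, Real.norm_of_nonneg (by positivity)]
    field_simp
  have key : ∀ ε : ℝ, ε ^ 2 = 1 → ∫ ψ : PureState n, 1 / 4 *
      (inner ℝ (realBasis a) (ψ : Qubits n) + ε * inner ℝ (realBasis b) (ψ : Qubits n)) ^ 4
        ∂(haarState n) =
      ∫ ψ : PureState n, (inner ℝ (realBasis a) (ψ : Qubits n)) ^ 4 ∂(haarState n) := by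
    intro ε hε
    rw [← integral_inner_pow_eq (u := (1 / Real.sqrt 2) • (realBasis a + ε • realBasis b))
      (by rw [hnorm ε hε, norm_realBasis]) 4]
    refine integral_congr_ae (ae_of_all _ fun ψ => ?_)
    simp only [inner_smul_left, inner_add_left, mul_pow]
    rw [conj_trivial, hs]
    simp
  have hb : ∫ ψ : PureState n, (inner ℝ (realBasis b) (ψ : Qubits n)) ^ 4 ∂(haarState n) =
      ∫ ψ : PureState n, (inner ℝ (realBasis a) (ψ : Qubits n)) ^ 4 ∂(haarState n) :=
    integral_inner_pow_eq (by rw [norm_realBasis, norm_realBasis]) 4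
  have k1 := key 1 (by norm_num)
  have k2 := key (-1) (by norm_num)
  have ca := continuous_real_inner (n := n) (realBasis a)
  have cb := continuous_real_inner (n := n) (realBasis b)
  have hadd := integral_add (μ := haarState n)
    (integrable_haarState (g := fun ψ : PureState n => 1 / 4 *
      (inner ℝ (realBasis a) (ψ : Qubits n) + 1 * inner ℝ (realBasis b) (ψ : Qubits n)) ^ 4)
      (by fun_prop))
    (integrable_haarState (g := fun ψ : PureState n => 1 / 4 *
      (inner ℝ (realBasis a) (ψ : Qubits n) + -1 * inner ℝ (realBasis b) (ψ : Qubits n)) ^ 4)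
      (by fun_prop))
  rw [k1, k2] at hadd
  have hexp : ∫ ψ : PureState n, (1 / 4 *
      (inner ℝ (realBasis a) (ψ : Qubits n) + 1 * inner ℝ (realBasis b) (ψ : Qubits n)) ^ 4 +
      1 / 4 *
      (inner ℝ (realBasis a) (ψ : Qubits n) + -1 * inner ℝ (realBasis b) (ψ : Qubits n)) ^ 4)
        ∂(haarState n) =
      ∫ ψ : PureState n, (1 / 2 * inner ℝ (realBasis a) (ψ : Qubits n) ^ 4 +
        1 / 2 * inner ℝ (realBasis b) (ψ : Qubits n) ^ 4 + 3 *
        ((inner ℝ (realBasis a) (ψ : Qubits n)) ^ 2 *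
          (inner ℝ (realBasis b) (ψ : Qubits n)) ^ 2)) ∂(haarState n) :=
    integral_congr_ae (ae_of_all _ fun ψ => by ring)
  rw [hexp, integral_add (integrable_haarState (by fun_prop)) (integrable_haarState (by fun_prop)),
    integral_add (integrable_haarState (by fun_prop)) (integrable_haarState (by fun_prop)),
    integral_const_mul, integral_const_mul, integral_const_mul, hb] at hadd
  linarith

/-- The square of `∑ a² = 1` expands into `(2 * 2^n)²` mixed moments. Off the diagonal each is `m /
3`, on the diagonal it is `m ≥ m / 3`, so `(2 * 2^n)² m / 3 ≤ 1`. -/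
theorem integral_inner_pow_four_le (a : (Fin n → Bool) × Bool) :
    ∫ ψ : PureState n, (inner ℝ (realBasis a) (ψ : Qubits n)) ^ 4 ∂(haarState n) ≤
      3 / (2 * 2 ^ n) ^ 2 := by
  set m := ∫ ψ : PureState n, (inner ℝ (realBasis a) (ψ : Qubits n)) ^ 4 ∂(haarState n) with hm
  have hm0 : 0 ≤ m := integral_nonneg fun ψ => by positivity
  have hall : ∀ b : (Fin n → Bool) × Bool,
      ∫ ψ : PureState n, (inner ℝ (realBasis b) (ψ : Qubits n)) ^ 4 ∂(haarState n) = m := fun b =>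
    integral_inner_pow_eq (by rw [norm_realBasis, norm_realBasis]) 4
  have hpair : ∀ b c : (Fin n → Bool) × Bool, m / 3 ≤
      ∫ ψ : PureState n, (inner ℝ (realBasis b) (ψ : Qubits n)) ^ 2 *
        (inner ℝ (realBasis c) (ψ : Qubits n)) ^ 2 ∂(haarState n) := by
    intro b c
    rcases eq_or_ne b c with rfl | hbc
    · have : ∫ ψ : PureState n, (inner ℝ (realBasis b) (ψ : Qubits n)) ^ 2 *
          (inner ℝ (realBasis b) (ψ : Qubits n)) ^ 2 ∂(haarState n) = m := by
        rw [← hall b]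
        exact integral_congr_ae (ae_of_all _ fun ψ => by ring)
      rw [this]
      linarith
    · rw [integral_inner_sq_mul_inner_sq hbc, hall]
  have hint : ∀ b c : (Fin n → Bool) × Bool, Integrable (fun ψ : PureState n =>
      (inner ℝ (realBasis b) (ψ : Qubits n)) ^ 2 *
        (inner ℝ (realBasis c) (ψ : Qubits n)) ^ 2) (haarState n) := fun b c =>
    integrable_haarState
      ((continuous_real_inner_pow (realBasis b) 2).mul (continuous_real_inner_pow (realBasis c) 2))
  have hone : ∑ b : (Fin n → Bool) × Bool, ∑ c : (Fin n → Bool) × Bool,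
      ∫ ψ : PureState n, (inner ℝ (realBasis b) (ψ : Qubits n)) ^ 2 *
        (inner ℝ (realBasis c) (ψ : Qubits n)) ^ 2 ∂(haarState n) = 1 := by
    simp only [← integral_finsetSum _ fun c _ => hint _ c]
    rw [← integral_finsetSum _ fun b _ => integrable_finsetSum _ fun c _ => hint b c]
    simp only [← Finset.mul_sum, sum_inner_realBasis_sq, mul_one]
    simp
  have hle : ∑ b : (Fin n → Bool) × Bool, ∑ c : (Fin n → Bool) × Bool, m / 3 ≤ 1 := by
    rw [← hone]
    exact Finset.sum_le_sum fun b _ => Finset.sum_le_sum fun c _ => hpair b c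
  rw [le_div_iff₀ (by positivity)]
  simp at hle
  linarith

theorem integral_norm_pow_four_le (x : Fin n → Bool) :
    ∫ ψ : PureState n, ‖(ψ : Qubits n) x‖ ^ 4 ∂(haarState n) ≤ 3 / (2 ^ n) ^ 2 := by
  have h1 := integral_inner_pow_four_le (x, false)
  have h2 := integral_inner_pow_four_le (x, true)
  have c1 := continuous_real_inner (n := n) (realBasis (x, false))
  have c2 := continuous_real_inner (n := n) (realBasis (x, true))
  -- This is `(a² + b²)² ≤ 2 a⁴ + 2 b⁴` for the real and imaginary parts.
  have hle : ∀ ψ : PureState n, ‖(ψ : Qubits n) x‖ ^ 4 ≤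
      2 * (inner ℝ (realBasis (x, false)) (ψ : Qubits n)) ^ 4 +
        2 * (inner ℝ (realBasis (x, true)) (ψ : Qubits n)) ^ 4 := by
    intro ψ
    rw [inner_realBasis, inner_realBasis,
      show ‖(ψ : Qubits n) x‖ ^ 4 = (‖(ψ : Qubits n) x‖ ^ 2) ^ 2 by ring,
      ← Complex.normSq_eq_norm_sq, Complex.normSq_apply]
    simp
    nlinarith [sq_nonneg (((ψ : Qubits n) x).re ^ 2 - ((ψ : Qubits n) x).im ^ 2)]
  have hcont : Continuous fun ψ : PureState n => ‖(ψ : Qubits n) x‖ ^ 4 := by fun_prop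
  calc _ ≤ ∫ ψ : PureState n, (2 * (inner ℝ (realBasis (x, false)) (ψ : Qubits n)) ^ 4 +
        2 * (inner ℝ (realBasis (x, true)) (ψ : Qubits n)) ^ 4) ∂(haarState n) :=
        integral_mono (integrable_haarState hcont) (integrable_haarState (by fun_prop)) hle
    _ ≤ 2 * (3 / (2 * 2 ^ n) ^ 2) + 2 * (3 / (2 * 2 ^ n) ^ 2) := by
        rw [integral_add (integrable_haarState (by fun_prop)) (integrable_haarState (by fun_prop)),
          integral_const_mul, integral_const_mul]
        gcongr
    _ = 3 / (2 ^ n) ^ 2 := by field_simp; norm_num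

/-- The real and imaginary parts of the complex inner product are the real inner products with `u`
and `i u`, both unit vectors. -/
theorem integral_norm_inner_sq {u : Qubits n} (hu : ‖u‖ = 1) :
    ∫ ψ : PureState n, ‖inner ℂ u (ψ : Qubits n)‖ ^ 2 ∂(haarState n) = 1 / 2 ^ n := by
  have h : ∀ ψ : PureState n, ‖inner ℂ u (ψ : Qubits n)‖ ^ 2 =
      (inner ℝ u (ψ : Qubits n)) ^ 2 + (inner ℝ (Complex.I • u) (ψ : Qubits n)) ^ 2 := by
    intro ψ
    have h1 : inner ℝ u (ψ : Qubits n) = (inner ℂ u (ψ : Qubits n)).re := by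
      rw [PiLp.inner_apply, PiLp.inner_apply, Complex.re_sum]
      exact Finset.sum_congr rfl fun x _ => by simp [Complex.inner]
    have h2 : inner ℝ (Complex.I • u) (ψ : Qubits n) = (inner ℂ u (ψ : Qubits n)).im := by
      rw [PiLp.inner_apply, PiLp.inner_apply, Complex.im_sum]
      exact Finset.sum_congr rfl fun x _ => by simp [Complex.inner]; ring
    rw [h1, h2, ← Complex.normSq_eq_norm_sq, Complex.normSq_apply]
    ring
  simp only [h]
  rw [integral_add (integrable_haarState (continuous_real_inner_pow _ 2))
    (integrable_haarState (continuous_real_inner_pow _ 2)), integral_inner_sq hu,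
    integral_inner_sq (by rw [norm_smul, hu]; simp)]
  field_simp
  norm_num

end HaarMoments

/-! ### The collision probability -/

theorem sum_prod_eq_pow {Ω : Type*} [Fintype Ω] (m : ℕ) (f : Ω → ℝ) :
    ∑ x : Fin m → Ω, ∏ i, f (x i) = (∑ a, f a) ^ m := by
  have h := Finset.prod_univ_sum (fun _ : Fin m => (Finset.univ : Finset Ω)) (fun _ a => f a)
  rw [Fintype.piFinset_univ] at h
  rw [← h]
  simp

-- After splitting by the common value `a` of `x i` and `x j`, the sum over `x` factors: positions
-- `i` and `j` give `f a` each, and every other position gives `1`.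
open Classical in
theorem sum_prod_filter_eq {Ω : Type*} [Fintype Ω] {m : ℕ} (f : Ω → ℝ) (hf : ∑ a, f a = 1)
    {i j : Fin m} (hij : i ≠ j) :
    ∑ x : Fin m → Ω, (if x i = x j then ∏ l, f (x l) else 0) = ∑ a, f a ^ 2 := by
  have h1 : ∀ x : Fin m → Ω, (if x i = x j then ∏ l, f (x l) else 0) =
      ∑ a, ∏ l, if l = i ∨ l = j then (if x l = a then f a else 0) else f (x l) := by
    intro x
    split_ifs with h
    · rw [Finset.sum_eq_single (x i)]
      · refine Finset.prod_congr rfl fun l _ => ?_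
        split_ifs with h1 h2
        · rw [h2]
        · rcases h1 with rfl | rfl
          · exact absurd rfl h2
          · exact absurd h.symm h2
        · rfl
      · intro a _ ha
        exact Finset.prod_eq_zero (Finset.mem_univ i) (by simp [ha.symm])
      · simp
    · symm
      refine Finset.sum_eq_zero fun a _ => ?_
      by_cases ha : x i = a
      · refine Finset.prod_eq_zero (Finset.mem_univ j) ?_
        rw [if_pos (.inr rfl), if_neg fun hj => h (ha.trans hj.symm)]
      · refine Finset.prod_eq_zero (Finset.mem_univ i) ?_
        rw [if_pos (.inl rfl), if_neg ha]
  simp only [h1]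
  rw [Finset.sum_comm]
  refine Finset.sum_congr rfl fun a _ => ?_
  have h2 := Finset.prod_univ_sum (fun _ : Fin m => (Finset.univ : Finset Ω))
    (fun l b => if l = i ∨ l = j then (if b = a then f a else 0) else f b)
  rw [Fintype.piFinset_univ] at h2
  rw [← h2]
  have h3 : ∀ l : Fin m, (∑ b, if l = i ∨ l = j then (if b = a then f a else 0) else f b) =
      if l = i ∨ l = j then f a else 1 := by
    intro l
    split_ifs
    · simp
    · exact hf
  simp only [h3]
  rw [Finset.prod_ite, Finset.prod_const, Finset.prod_const_one, mul_one]
  congr 1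
  rw [← Finset.card_pair hij]
  congr 1
  ext l
  simp

/-- Union bound over ordered pairs of positions. A given pair collides with probability `∑ |ψ_a|⁴`;
counting ordered pairs and then the diagonal only costs a constant factor. -/
theorem collisionProb_le {n : ℕ} (m : ℕ) (ψ : PureState n) :
    collisionProb m (ψ : Qubits n) ≤ (m : ℝ) ^ 2 * ∑ a, ‖(ψ : Qubits n) a‖ ^ 4 := by
  classical
  have hpos : ∀ x : Fin m → Fin n → Bool, 0 ≤ ∏ l, ‖(ψ : Qubits n) (x l)‖ ^ 2 := fun x =>
    Finset.prod_nonneg fun l _ => by positivity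
  have hS : 0 ≤ ∑ a, ‖(ψ : Qubits n) a‖ ^ 4 := Finset.sum_nonneg fun a _ => by positivity
  calc collisionProb m (ψ : Qubits n)
      = ∑ x : Fin m → Fin n → Bool, if ¬ Function.Injective x then
          ∏ l, ‖(ψ : Qubits n) (x l)‖ ^ 2 else 0 := by
        rw [collisionProb, Finset.sum_filter]
    _ ≤ ∑ x : Fin m → Fin n → Bool, ∑ i, ∑ j, if i ≠ j then
          (if x i = x j then ∏ l, ‖(ψ : Qubits n) (x l)‖ ^ 2 else 0) else 0 := by
        refine Finset.sum_le_sum fun x _ => ?_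
        have hterm : ∀ i j, 0 ≤ if i ≠ j then
          (if x i = x j then ∏ l, ‖(ψ : Qubits n) (x l)‖ ^ 2 else 0) else 0 := by
          intro i j
          split_ifs
          exacts [hpos x, le_rfl, le_rfl]
        split_ifs with h
        · exact Finset.sum_nonneg fun i _ => Finset.sum_nonneg fun j _ => hterm i j
        · obtain ⟨i, j, hx, hij⟩ : ∃ i j, x i = x j ∧ i ≠ j := by
            simpa [Function.Injective] using h
          calc _ = if i ≠ j then
                (if x i = x j then ∏ l, ‖(ψ : Qubits n) (x l)‖ ^ 2 else 0) else 0 := by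
                rw [if_pos hij, if_pos hx]
            _ ≤ ∑ j, if i ≠ j then
                (if x i = x j then ∏ l, ‖(ψ : Qubits n) (x l)‖ ^ 2 else 0) else 0 :=
                Finset.single_le_sum (f := fun j => if i ≠ j then
                  (if x i = x j then ∏ l, ‖(ψ : Qubits n) (x l)‖ ^ 2 else 0) else 0)
                  (fun j _ => hterm i j) (Finset.mem_univ j)
            _ ≤ _ := Finset.single_le_sum (f := fun i => ∑ j, if i ≠ j then
                  (if x i = x j then ∏ l, ‖(ψ : Qubits n) (x l)‖ ^ 2 else 0) else 0)
                  (fun i _ => Finset.sum_nonneg fun j _ => hterm i j) (Finset.mem_univ i)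
    _ = ∑ i : Fin m, ∑ j, if i ≠ j then ∑ a, ‖(ψ : Qubits n) a‖ ^ 4 else 0 := by
        rw [Finset.sum_comm]
        refine Finset.sum_congr rfl fun i _ => ?_
        rw [Finset.sum_comm]
        refine Finset.sum_congr rfl fun j _ => ?_
        split_ifs with h
        · refine Eq.trans (Finset.sum_congr rfl fun x _ => by congr)
            ((sum_prod_filter_eq (fun a => ‖(ψ : Qubits n) a‖ ^ 2) ψ.sum_norm_sq h).trans ?_)
          exact Finset.sum_congr rfl fun a _ => by ring
        · simp
    _ ≤ ∑ i : Fin m, ∑ j : Fin m, ∑ a, ‖(ψ : Qubits n) a‖ ^ 4 := by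
        refine Finset.sum_le_sum fun i _ => Finset.sum_le_sum fun j _ => ?_
        split_ifs
        exacts [le_rfl, hS]
    _ = _ := by simp; ring

theorem continuous_collisionProb (n m : ℕ) :
    Continuous fun ψ : PureState n => collisionProb m (ψ : Qubits n) := by
  unfold collisionProb
  fun_prop

theorem integral_collisionProb_le (n m : ℕ) :
    ∫ ψ : PureState n, collisionProb m (ψ : Qubits n) ∂(haarState n) ≤ 3 * (m : ℝ) ^ 2 / 2 ^ n := by
  have hint : ∀ a : Fin n → Bool, Integrable (fun ψ : PureState n => ‖(ψ : Qubits n) a‖ ^ 4)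
      (haarState n) := fun a => integrable_haarState (by fun_prop)
  calc _ ≤ ∫ ψ : PureState n, (m : ℝ) ^ 2 * ∑ a, ‖(ψ : Qubits n) a‖ ^ 4 ∂(haarState n) :=
        integral_mono (integrable_haarState (continuous_collisionProb n m))
          ((integrable_finsetSum _ fun a _ => hint a).const_mul _) (collisionProb_le m)
    _ = (m : ℝ) ^ 2 * ∑ a, ∫ ψ : PureState n, ‖(ψ : Qubits n) a‖ ^ 4 ∂(haarState n) := by
        rw [integral_const_mul, integral_finsetSum _ fun a _ => hint a]
    _ ≤ (m : ℝ) ^ 2 * ∑ a : Fin n → Bool, 3 / (2 ^ n) ^ 2 := by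
        gcongr with a
        exact integral_norm_pow_four_le a
    _ = 3 * (m : ℝ) ^ 2 / 2 ^ n := by
        simp
        field_simp

/-! ### Subset states -/

theorem norm_subsetState_apply_sq {n : ℕ} (S : Finset (Fin n → Bool)) (x : Fin n → Bool) :
    ‖subsetState S x‖ ^ 2 = if x ∈ S then 1 / (S.card : ℝ) else 0 := by
  simp only [subsetState]
  split_ifs
  · rw [Complex.norm_real, Real.norm_of_nonneg (by positivity), div_pow,
      Real.sq_sqrt (by positivity), one_pow]
  · simp

theorem norm_subsetState {n : ℕ} {S : Finset (Fin n → Bool)} (hS : S.Nonempty) :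
    ‖subsetState S‖ = 1 := by
  have hc : (S.card : ℝ) ≠ 0 := by exact_mod_cast hS.card_pos.ne'
  have h : ‖subsetState S‖ ^ 2 = 1 := by
    rw [EuclideanSpace.norm_sq_eq]
    simp only [norm_subsetState_apply_sq]
    simp [hc]
  exact (pow_eq_one_iff_of_nonneg (norm_nonneg _) two_ne_zero).1 h

theorem collisionProb_subsetState {n : ℕ} {S : Finset (Fin n → Bool)} (hS : S.Nonempty) :
    collisionProb (S.card + 1) (subsetState S) = 1 := by
  classical
  have hc : (S.card : ℝ) ≠ 0 := by exact_mod_cast hS.card_pos.ne'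
  have hsum : ∑ x, ‖subsetState S x‖ ^ 2 = 1 := by
    simp only [norm_subsetState_apply_sq]
    simp [hc]
  rw [collisionProb, Finset.sum_filter_of_ne, sum_prod_eq_pow _ fun a => ‖subsetState S a‖ ^ 2,
    hsum, one_pow]
  intro x _ hx hinj
  refine hx ?_
  -- Pigeonhole: an injective sample of `|S| + 1` strings leaves `S`, so its weight is zero and
  -- restricting to non-injective samples loses nothing.
  have hex : ∃ i, x i ∉ S := by
    by_contra hall
    push Not at hall
    have := Finset.card_le_card_of_injOn x (s := Finset.univ) (t := S) (fun i _ => hall i)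
      hinj.injOn
    simp at this
  obtain ⟨i, hi⟩ := hex
  exact Finset.prod_eq_zero (Finset.mem_univ i) (by rw [norm_subsetState_apply_sq, if_neg hi])

theorem swapTestProb_subsetState {n : ℕ} {S : Finset (Fin n → Bool)} (hS : S.Nonempty) :
    swapTestProb (subsetState S) = (1 + S.card / 2 ^ n) / 2 := by
  have hc : 0 < (S.card : ℝ) := by exact_mod_cast hS.card_pos
  have h : inner ℂ (subsetState (Finset.univ : Finset (Fin n → Bool))) (subsetState S) =
      ((1 / Real.sqrt (2 ^ n) * (S.card * (1 / Real.sqrt S.card)) : ℝ) : ℂ) := by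
    simp [PiLp.inner_apply, subsetState]
    ring
  rw [swapTestProb, h, Complex.norm_real, Real.norm_of_nonneg (by positivity), mul_pow, mul_pow,
    div_pow, div_pow, Real.sq_sqrt (by positivity), Real.sq_sqrt hc.le]
  congr 2
  field_simp

/-! ### Tails of the binomial distribution -/

theorem sum_binomial_variance (k : ℕ) (q : ℝ) :
    ∑ j ∈ Finset.range (k + 1), (k * q - j) ^ 2 * ((k.choose j : ℝ) * q ^ j * (1 - q) ^ (k - j)) =
      k * q * (1 - q) := by
  have h := congrArg (Polynomial.eval q) (bernsteinPolynomial.variance ℝ k)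
  simpa [eval_finsetSum, bernsteinPolynomial] using h

theorem sum_binomial (k : ℕ) (q : ℝ) :
    ∑ j ∈ Finset.range (k + 1), (k.choose j : ℝ) * q ^ j * (1 - q) ^ (k - j) = 1 := by
  have h := add_pow q (1 - q) k
  rw [add_sub_cancel, one_pow] at h
  exact (Finset.sum_congr rfl fun j _ => by ring).trans h.symm

/-- Chebyshev's inequality, with the variance `k q (1 - q)` bounded by `k / 4`. -/
theorem sum_binomial_le_of_sq_le {k : ℕ} {q δ : ℝ} (hq0 : 0 ≤ q) (hq1 : q ≤ 1) (hδ : 0 < δ)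
    {s : Finset ℕ} (hs : s ⊆ Finset.range (k + 1)) (h : ∀ j ∈ s, δ ^ 2 ≤ (k * q - j) ^ 2) :
    ∑ j ∈ s, (k.choose j : ℝ) * q ^ j * (1 - q) ^ (k - j) ≤ k / (4 * δ ^ 2) := by
  have hpos : ∀ j, 0 ≤ (k.choose j : ℝ) * q ^ j * (1 - q) ^ (k - j) := fun j => by
    have : 0 ≤ 1 - q := by linarith
    positivity
  rw [le_div_iff₀ (by positivity)]
  calc (∑ j ∈ s, (k.choose j : ℝ) * q ^ j * (1 - q) ^ (k - j)) * (4 * δ ^ 2)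
      = 4 * ∑ j ∈ s, δ ^ 2 * ((k.choose j : ℝ) * q ^ j * (1 - q) ^ (k - j)) := by
        rw [← Finset.mul_sum]; ring
    _ ≤ 4 * ∑ j ∈ s, (k * q - j) ^ 2 * ((k.choose j : ℝ) * q ^ j * (1 - q) ^ (k - j)) := by
        exact mul_le_mul_of_nonneg_left (Finset.sum_le_sum fun j hj =>
          mul_le_mul_of_nonneg_right (h j hj) (hpos j)) (by norm_num)
    _ ≤ 4 * ∑ j ∈ Finset.range (k + 1),
          (k * q - j) ^ 2 * ((k.choose j : ℝ) * q ^ j * (1 - q) ^ (k - j)) := by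
        exact mul_le_mul_of_nonneg_left (Finset.sum_le_sum_of_subset_of_nonneg hs
          fun j _ _ => mul_nonneg (sq_nonneg _) (hpos j)) (by norm_num)
    _ ≤ k := by
        rw [sum_binomial_variance]
        nlinarith [mul_nonneg (Nat.cast_nonneg (α := ℝ) k) (sq_nonneg (1 - 2 * q))]

theorem atLeastProb_le_one (k t : ℕ) {q : ℝ} (hq0 : 0 ≤ q) (hq1 : q ≤ 1) :
    atLeastProb k t q ≤ 1 := by
  rw [← sum_binomial k q, atLeastProb]
  refine Finset.sum_le_sum_of_subset_of_nonneg (fun j hj => ?_) fun j _ _ => ?_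
  · have := Finset.mem_Icc.1 hj
    exact Finset.mem_range.2 (by lia)
  · have : 0 ≤ 1 - q := by linarith
    positivity

theorem atLeastProb_le {k t : ℕ} {q δ : ℝ} (hq0 : 0 ≤ q) (hq1 : q ≤ 1) (hδ : 0 < δ)
    (h : k * q + δ ≤ t) : atLeastProb k t q ≤ k / (4 * δ ^ 2) := by
  refine sum_binomial_le_of_sq_le hq0 hq1 hδ (fun j hj => ?_) fun j hj => ?_
  · have := Finset.mem_Icc.1 hj
    exact Finset.mem_range.2 (by lia)
  · have : (t : ℝ) ≤ j := by exact_mod_cast (Finset.mem_Icc.1 hj).1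
    nlinarith

theorem one_sub_le_atLeastProb {k t : ℕ} {q δ : ℝ} (hq0 : 0 ≤ q) (hq1 : q ≤ 1) (hδ : 0 < δ)
    (h : t + δ ≤ k * q) : 1 - k / (4 * δ ^ 2) ≤ atLeastProb k t q := by
  have hsplit : Finset.Icc t k = (Finset.range (k + 1)).filter (t ≤ ·) := by
    ext j
    simp
    lia
  have h1 := Finset.sum_filter_add_sum_filter_not (Finset.range (k + 1)) (t ≤ ·)
    fun j => (k.choose j : ℝ) * q ^ j * (1 - q) ^ (k - j)
  rw [sum_binomial, ← hsplit] at h1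
  have h2 : ∑ j ∈ (Finset.range (k + 1)).filter (¬ t ≤ ·),
      (k.choose j : ℝ) * q ^ j * (1 - q) ^ (k - j) ≤ k / (4 * δ ^ 2) := by
    refine sum_binomial_le_of_sq_le hq0 hq1 hδ (Finset.filter_subset _ _) fun j hj => ?_
    have : (j : ℝ) ≤ t := by exact_mod_cast (not_le.1 (Finset.mem_filter.1 hj).2).le
    nlinarith
  rw [atLeastProb]
  linarith

/-! ### Polynomials against exponentials -/

theorem tendsto_eval_div_pow (q : ℕ[X]) {r : ℝ} (hr : 1 < r) :
    Tendsto (fun n : ℕ => ((q.eval n : ℕ) : ℝ) / r ^ n) atTop (nhds 0) := by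
  induction q using Polynomial.induction_on' with
  | add p q hp hq => simpa [add_div] using hp.add hq
  | monomial k a =>
    simpa [mul_div_assoc] using (tendsto_pow_const_div_const_pow_of_one_lt k hr).const_mul (a : ℝ)

theorem eventually_eval_le_pow (q : ℕ[X]) {r : ℝ} (hr : 1 < r) :
    ∀ᶠ n : ℕ in atTop, ((q.eval n : ℕ) : ℝ) ≤ r ^ n := by
  filter_upwards [(tendsto_eval_div_pow q hr).eventually_lt_const one_pos] with n hn
  rw [div_lt_one (by positivity)] at hn
  exact hn.le

/-! ### The two tests -/

theorem exists_collision_bound (p : ℚ[X]) : ∃ c : ℝ, 0 < c ∧ ∀ᶠ n : ℕ in atTop,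
    3 * ((⌊p.eval (n : ℚ)⌋₊ + 1 : ℕ) : ℝ) ^ 2 / 2 ^ n ≤ Real.exp (-(c * n)) := by
  obtain ⟨P, hP⟩ := exists_eval_le p
  have hlog : 0 < Real.log 2 / 2 := by positivity
  -- With `r = √2` we have `2^n = r^n r^n`: one factor absorbs the polynomial and the other is the
  -- claimed decay.
  refine ⟨Real.log 2 / 2, hlog, ?_⟩
  filter_upwards [eventually_eval_le_pow (3 * (P + 1) ^ 2) (Real.one_lt_exp_iff.2 hlog)] with n hn
  set r := Real.exp (Real.log 2 / 2) with hr
  have hr2 : r * r = 2 := by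
    rw [hr, ← Real.exp_add, add_halves, Real.exp_log two_pos]
  have hexp : Real.exp (-(Real.log 2 / 2 * n)) = 1 / r ^ n := by
    rw [Real.exp_neg, mul_comm, Real.exp_nat_mul, one_div]
  have hfl : ((⌊p.eval (n : ℚ)⌋₊ + 1 : ℕ) : ℝ) ≤ (P.eval n : ℕ) + 1 := by
    have : ⌊p.eval (n : ℚ)⌋₊ ≤ P.eval n := Nat.floor_le_of_le (hP n).2
    exact_mod_cast Nat.add_le_add_right this 1
  have hrpos : 0 < r := Real.exp_pos _
  rw [hexp, div_le_div_iff₀ (by positivity) (by positivity), one_mul, ← hr2, mul_pow]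
  gcongr
  refine le_trans ?_ hn
  simp only [eval_mul, eval_pow, eval_add, eval_one, eval_ofNat]
  push_cast at hfl ⊢
  gcongr

theorem swapTestProb_nonneg {n : ℕ} (ψ : Qubits n) : 0 ≤ swapTestProb ψ := by
  unfold swapTestProb
  positivity

theorem swapTestProb_le_one {n : ℕ} (ψ : PureState n) : swapTestProb (ψ : Qubits n) ≤ 1 := by
  have h := norm_inner_le_norm (𝕜 := ℂ) (subsetState (Finset.univ : Finset (Fin n → Bool)))
    (ψ : Qubits n)
  rw [norm_subsetState Finset.univ_nonempty, norm_eq_of_mem_sphere, one_mul] at h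
  rw [swapTestProb]
  have := pow_le_one₀ (n := 2) (norm_nonneg _) h
  linarith

theorem continuous_atLeastProb_swapTestProb (n k t : ℕ) :
    Continuous fun ψ : PureState n => atLeastProb k t (swapTestProb (ψ : Qubits n)) := by
  unfold atLeastProb swapTestProb
  fun_prop

/-- A threshold slightly above one half is rarely reached by a Haar random state. -/
theorem integral_atLeastProb_le (n : ℕ) {P : ℕ} (hP : 1 ≤ P) :
    ∫ ψ : PureState n, atLeastProb (64 * P ^ 2) (32 * P ^ 2 + 16 * P)
      (swapTestProb (ψ : Qubits n)) ∂(haarState n) ≤ 1 / 4 + 4 * P / 2 ^ n := by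
  have hP' : (1 : ℝ) ≤ P := by exact_mod_cast hP
  set u := subsetState (Finset.univ : Finset (Fin n → Bool)) with hu
  have hcont : Continuous fun ψ : PureState n => ‖inner ℂ u (ψ : Qubits n)‖ ^ 2 := by fun_prop
  have hle : ∀ ψ : PureState n, atLeastProb (64 * P ^ 2) (32 * P ^ 2 + 16 * P)
      (swapTestProb (ψ : Qubits n)) ≤ 1 / 4 + 4 * P * ‖inner ℂ u (ψ : Qubits n)‖ ^ 2 := by
    intro ψ
    set a := ‖inner ℂ u (ψ : Qubits n)‖ ^ 2 with ha
    have ha0 : 0 ≤ a := by positivity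
    -- If `a ≤ 1 / (4 P)`, the mean `32 P² (1 + a)` is at most `32 P² + 8 P`, which is `8 P` below
    -- the threshold, and Chebyshev gives `64 P² / (4 (8 P)²) = 1 / 4`. Otherwise the second term of
    -- the bound already exceeds or equals `1`.
    rcases le_total (4 * P * a) 1 with h | h
    · have := atLeastProb_le (k := 64 * P ^ 2) (t := 32 * P ^ 2 + 16 * P) (δ := 8 * P)
        (swapTestProb_nonneg (ψ : Qubits n)) (swapTestProb_le_one ψ) (by positivity) (by
          rw [swapTestProb, ← hu, ← ha]
          push_cast
          nlinarith)
      refine this.trans ?_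
      have h4 : ((64 * P ^ 2 : ℕ) : ℝ) / (4 * (8 * P) ^ 2) = 1 / 4 := by
        push_cast
        field_simp
        norm_num
      rw [h4]
      have : 0 ≤ 4 * P * a := by positivity
      linarith
    · have := atLeastProb_le_one (64 * P ^ 2) (32 * P ^ 2 + 16 * P)
        (swapTestProb_nonneg (ψ : Qubits n)) (swapTestProb_le_one ψ)
      linarith
  calc _ ≤ ∫ ψ : PureState n, (1 / 4 + 4 * P * ‖inner ℂ u (ψ : Qubits n)‖ ^ 2) ∂(haarState n) :=
        integral_mono (integrable_haarState (continuous_atLeastProb_swapTestProb n _ _))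
          (integrable_haarState (by fun_prop)) hle
    _ = 1 / 4 + 4 * P / 2 ^ n := by
        rw [integral_add (integrable_haarState (by fun_prop)) (integrable_haarState (by fun_prop)),
          integral_const_mul, integral_norm_inner_sq (norm_subsetState Finset.univ_nonempty)]
        simp
        ring

theorem le_atLeastProb_subsetState {n : ℕ} {P : ℕ} (hP : 1 ≤ P) (hn : (4 * P : ℝ) ≤ 2 ^ n)
    {S : Finset (Fin n → Bool)} (hS : S.Nonempty) (hc : 2 ^ n / (P : ℝ) - 1 ≤ S.card) :
    3 / 4 ≤ atLeastProb (64 * P ^ 2) (32 * P ^ 2 + 16 * P) (swapTestProb (subsetState S)) := by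
  have hP' : (1 : ℝ) ≤ P := by exact_mod_cast hP
  have h1 : swapTestProb (subsetState S) ≤ 1 :=
    swapTestProb_le_one ⟨subsetState S, by simp [norm_subsetState hS]⟩
  have h := one_sub_le_atLeastProb (k := 64 * P ^ 2) (t := 32 * P ^ 2 + 16 * P) (δ := 8 * P)
    (swapTestProb_nonneg (subsetState S)) h1 (by positivity) (by
      rw [swapTestProb_subsetState hS]
      have hN : (0 : ℝ) < 2 ^ n := by positivity
      -- Rounding loses at most `1 / 2^n ≤ 1 / (4 P)` from `1 / P`. The mean is then at least `32 P²
      -- + 24 P`, which is `8 P` above the threshold.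
      have h2 : 3 / (4 * P : ℝ) ≤ S.card / 2 ^ n := by
        rw [div_le_div_iff₀ (by positivity) hN]
        have h3 : (2 ^ n : ℝ) ≤ (S.card + 1) * P := by
          rw [← div_le_iff₀ (by positivity)]
          linarith
        nlinarith
      rw [div_le_iff₀ (by positivity)] at h2
      push_cast
      have h5 : 24 * (P : ℝ) ≤ 32 * P ^ 2 * (S.card / 2 ^ n) := by nlinarith
      linarith)
  have h4 : ((64 * P ^ 2 : ℕ) : ℝ) / (4 * (8 * P) ^ 2) = 1 / 4 := by
    push_cast
    field_simp
    norm_num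
  rw [h4] at h
  linarith

theorem two_pow_div_sub_one_le_card {s P n : ℕ} {p : ℚ} (hs : 1 ≤ s) (hp : p ≤ P)
    (h : |(s : ℚ) - 2 ^ n / p| < 1) : (2 ^ n / (P : ℝ) - 1 : ℝ) ≤ s := by
  obtain ⟨h1, h2⟩ := abs_lt.1 h
  have hs' : (1 : ℚ) ≤ s := by exact_mod_cast hs
  -- For `p ≤ 0`, including `p = 0` where the quotient is `0`, a set of size at least `1` is at
  -- distance at least `1` from `2^n / p`.
  have hp0 : 0 < p := by
    by_contra hne
    have : (2 : ℚ) ^ n / p ≤ 0 := div_nonpos_of_nonneg_of_nonpos (by positivity) (not_lt.1 hne)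
    linarith
  have h3 : (2 : ℚ) ^ n / P ≤ 2 ^ n / p := by gcongr
  have h4 : (2 ^ n / (P : ℚ) - 1 : ℚ) ≤ s := by linarith
  have h5 := (Rat.cast_le (K := ℝ)).2 h4
  push_cast at h5
  exact h5

theorem mainTheorem4 :
    (∀ p : ℚ[X], ∃ A : Prog, A.PolyTime ∧
      (∀ (n : ℕ) (ψ : PureState n),
        acceptProb A (⌊p.eval (n : ℚ)⌋₊ + 1) (ψ : Qubits n) =
          collisionProb (⌊p.eval (n : ℚ)⌋₊ + 1) (ψ : Qubits n)) ∧
      (∀ (n : ℕ) (S : Finset (Fin n → Bool)), S.Nonempty →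
        (S.card : ℚ) = p.eval (n : ℚ) →
        acceptProb A (⌊p.eval (n : ℚ)⌋₊ + 1) (subsetState S) = 1) ∧
      (∃ c : ℝ, 0 < c ∧ ∀ᶠ n : ℕ in atTop,
        haarAcceptProb A (⌊p.eval (n : ℚ)⌋₊ + 1) n ≤ Real.exp (-(c * n)))) ∧
    (∃ c : ℝ, 0 < c ∧ ∀ p : ℚ[X], ∃ A : Prog, A.PolyTime ∧ ∃ k t : ℕ → ℕ,
      (∃ q : ℕ[X], ∀ n, k n ≤ q.eval n) ∧
      (∀ (n : ℕ) (ψ : PureState n),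
        acceptProb A (k n) (ψ : Qubits n) =
          atLeastProb (k n) (t n) (swapTestProb (ψ : Qubits n))) ∧
      (∀ᶠ n : ℕ in atTop, ∀ S : Finset (Fin n → Bool), S.Nonempty →
        |(S.card : ℚ) - 2 ^ n / p.eval (n : ℚ)| < 1 →
        c ≤ acceptProb A (k n) (subsetState S) - haarAcceptProb A (k n) n)) := by
  constructor
  · intro p
    obtain ⟨A, hA, h⟩ := exists_collision_algorithm p
    refine ⟨A, hA, fun n ψ => h n ψ, fun n S hS hcard => ?_, ?_⟩
    · rw [h, ← hcard, Nat.floor_natCast, collisionProb_subsetState hS]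
    · obtain ⟨c, hc, hev⟩ := exists_collision_bound p
      refine ⟨c, hc, hev.mono fun n hn => le_trans ?_ hn⟩
      simp only [haarAcceptProb, h]
      exact integral_collisionProb_le n _
  · refine ⟨1 / 4, by norm_num, fun p => ?_⟩
    obtain ⟨P, hP⟩ := exists_eval_le p
    obtain ⟨A, hA, h⟩ := exists_swapTest_algorithm (64 * P ^ 2) (32 * P ^ 2 + 16 * P)
    refine ⟨A, hA, fun n => (64 * P ^ 2 : ℕ[X]).eval n,
      fun n => (32 * P ^ 2 + 16 * P : ℕ[X]).eval n, ⟨_, fun n => le_rfl⟩, h, ?_⟩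
    filter_upwards [eventually_eval_le_pow (16 * P) one_lt_two] with n hn S hS hcard
    have h16 : 16 * ((P.eval n : ℕ) : ℝ) ≤ 2 ^ n := by simpa using hn
    have hk : (64 * P ^ 2 : ℕ[X]).eval n = 64 * (P.eval n) ^ 2 := by simp
    have ht : (32 * P ^ 2 + 16 * P : ℕ[X]).eval n = 32 * (P.eval n) ^ 2 + 16 * P.eval n := by simp
    have h1 := le_atLeastProb_subsetState (hP n).1
      (by linarith [Nat.cast_nonneg (α := ℝ) (P.eval n)]) hS
      (two_pow_div_sub_one_le_card hS.card_pos (hP n).2 hcard)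
    have h2 := integral_atLeastProb_le n (hP n).1
    have h3 : 4 * ((P.eval n : ℕ) : ℝ) / 2 ^ n ≤ 1 / 4 := by
      rw [div_le_iff₀ (by positivity)]
      linarith
    have h4 := h n ⟨subsetState S, by simp [norm_subsetState hS]⟩
    simp only [haarAcceptProb, h]
    rw [hk, ht] at h4 ⊢
    rw [h4]
    linarith
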